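/- Let $G=\mathbb C^*$ act linearly on a finite-dimensional complex vector space $V$ with coordinate functions $x_i$, $i\in I$, where $t\in G$ multiplies the $i$-th coordinate by $t^{w_i}$, $w_i\in\mathbb Z$. Let $r_1,\dots,r_d$ be the positive weights and $-s_1,\dots,-s_e$ the negative weights, listed with multiplicity (the weight $0$ may also occur). Assume $d,e\ge 1$ and that the greatest common divisor of all weights is $1$. Let $Z=\operatorname{Spec}\mathcal O(V)^G$ with quotient map $p\colon V\to Z$. For $0\le m\le\infty$ let $X_m$ denote the $m$-th jet scheme of an affine scheme $X$ (the arc space if $m=\infty$), i.e. $\operatorname{Hom}(\mathcal O(X_m),A)=\operatorname{Hom}(\mathcal O(X),A[t]/(t^{m+1}))$, respectively $\operatorname{Hom}(\mathcal O(X),A[[t]])$, for all $\mathbb C$-algebras $A$. Then $G_m$ acts on $V_m$, and $p$ induces $p_m^*\colon\mathcal O(Z_m)\to\mathcal O(V_m)^{G_m}$. Let $D$ be the canonical derivation of $\mathcal O(V_\infty)$, let $V'\subseteq V$ be the set of points where the rank of $dp$ is maximal, and let $Z'=p(V')$. Call $f\in \mathcal O(V_\infty)^{G_\infty}$ new if it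 is not in the image of $p_\infty^*$. Then: (a) $p_\infty^*$ is surjective if and only if one of the following holds: (1) $d=1$ and $r_1=1$, or $e=1$ and $s_1=1$; (2) all the $r_i$ and $s_j$ are equal to $1$. (b) In case (1), $Z'=Z$, and $p_m^*$ is an isomorphism for all $0\le m\le\infty$. (c) If neither (1) nor (2) holds, then there are weights $w_i=r\ge 2$ and $w_j=-s\le -2$, or there are indices $i_1\neq i_2$ and $j$ such that, up to a common sign, $w_{i_1}=w_{i_2}=1$ and $w_j=-s$ with $s\ge 2$. In these situations there are the following new invariants. (c1) If $i_1\ne i_2$ and $j$ are as above, then $(x_{i_1}Dx_{i_2}-x_{i_2}Dx_{i_1})\,x_{i_1}^{s-2}x_j$ is a new invariant. (c2) If $w_i=r\ge2$, $w_j=-s\le-2$ and $\gcd(r,s)=1$, then $(Dq)^2/q$ with $q=x_i^{s}x_j^{r}$ lies in $\mathcal O(V_\infty)$ and is a new invariant. (c3) If $w_i=r\ge2$, $w_j=-s\le-2$ and $g:=\gcd(r,s)>1$, then there are an index $k$ with $g\nmid w_k$ and integers $\alpha,\beta\ge 2$ such that, with $n=g/\gcd(g,w_k)$, one has $nw_k+\alpha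 r-\beta s=0$ and, for $q=x_k^{n}x_i^{\alpha}x_j^{\beta}$, the element $(Dq)^2/q$ lies in $\mathcal O(V_\infty)$ and is a new invariant. -/

import Mathlib

/-! # Jet schemes and arc spaces of a linear representation of `ℂˣ`

For `m : ℕ∞`, `m = ⊤` stands for the arc space. -/

noncomputable section

namespace ArcInv

/-! ## Truncated power series -/

/-- The ideal of `A[[t]]` of the series whose coefficients of `t ^ k`, `k ≤ m`, all vanish:
`t ^ (m + 1) A[[t]]` for finite `m`, and `0` for `m = ⊤`. -/
def jetIdeal (m : ℕ∞) (A : Type*) [CommRing A] : Ideal (PowerSeries A) where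
  carrier := {f | ∀ k : ℕ, (k : ℕ∞) ≤ m → PowerSeries.coeff k f = 0}
  add_mem' := by
    intro f g hf hg k hk
    simp [hf k hk, hg k hk]
  zero_mem' := by
    intro k _
    simp
  smul_mem' := by
    intro c f hf k hk
    rw [smul_eq_mul, PowerSeries.coeff_mul]
    refine Finset.sum_eq_zero fun p hp => ?_
    have hle : p.2 ≤ k := by
      have := Finset.HasAntidiagonal.mem_antidiagonal.mp hp
      omega
    rw [hf p.2 (le_trans (by exact_mod_cast hle) hk), mul_zero]

/-- `A[t]/(t ^ (m + 1))` for finite `m`, and `A[[t]]` for `m = ⊤`. -/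
abbrev JetRing (m : ℕ∞) (A : Type*) [CommRing A] : Type _ :=
  PowerSeries A ⧸ jetIdeal m A

/-- The orders `k ≤ m`. -/
abbrev JetIdx (m : ℕ∞) : Type := {k : ℕ // (k : ℕ∞) ≤ m}

/-- The coefficient of `t ^ k`, `k ≤ m`. -/
def jcoeff {m : ℕ∞} {A : Type*} [CommRing A] (k : JetIdx m) : JetRing m A →+ A :=
  QuotientAddGroup.lift (jetIdeal m A).toAddSubgroup
    (PowerSeries.coeff (R := A) k.1).toAddMonoidHom (fun _ hf => hf k.1 k.2)

theorem jcoeff_mk {m : ℕ∞} {A : Type*} [CommRing A] (k : JetIdx m) (f : PowerSeries A) :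
    jcoeff k (Ideal.Quotient.mk (jetIdeal m A) f) = PowerSeries.coeff k.1 f := rfl

theorem JetRing.ext {m : ℕ∞} {A : Type*} [CommRing A] {f g : JetRing m A}
    (h : ∀ k : JetIdx m, jcoeff k f = jcoeff k g) : f = g := by
  obtain ⟨f, rfl⟩ := Ideal.Quotient.mk_surjective f
  obtain ⟨g, rfl⟩ := Ideal.Quotient.mk_surjective g
  rw [Ideal.Quotient.mk_eq_mk_iff_sub_mem]
  intro k hk
  have := h ⟨k, hk⟩
  rw [jcoeff_mk, jcoeff_mk] at this
  rw [map_sub, this, sub_self]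

open Classical in
/-- The truncated series `∑_{k ≤ m} c k t ^ k`. -/
def jmk {m : ℕ∞} {A : Type*} [CommRing A] (c : JetIdx m → A) : JetRing m A :=
  Ideal.Quotient.mk _ (PowerSeries.mk fun k => if h : (k : ℕ∞) ≤ m then c ⟨k, h⟩ else 0)

theorem jcoeff_jmk {m : ℕ∞} {A : Type*} [CommRing A] (c : JetIdx m → A) (k : JetIdx m) :
    jcoeff k (jmk c) = c k := by
  rw [jmk, jcoeff_mk, PowerSeries.coeff_mk, dif_pos k.2]

/-- Functoriality of the truncated power series ring in the coefficients. -/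
def jmap (m : ℕ∞) {A B : Type*} [CommRing A] [CommRing B] [Algebra ℂ A] [Algebra ℂ B]
    (φ : A →ₐ[ℂ] B) : JetRing m A →ₐ[ℂ] JetRing m B :=
  Ideal.quotientMapₐ (jetIdeal m B) (PowerSeries.mapAlgHom φ) (by
    intro f hf k hk
    have h0 : PowerSeries.coeff k (PowerSeries.map (φ : A →+* B) f) = 0 := by
      rw [PowerSeries.coeff_map, hf k hk, map_zero]
    exact h0)

theorem jcoeff_jmap {m : ℕ∞} {A B : Type*} [CommRing A] [CommRing B] [Algebra ℂ A] [Algebra ℂ B]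
    (φ : A →ₐ[ℂ] B) (k : JetIdx m) (f : JetRing m A) :
    jcoeff k (jmap m φ f) = φ (jcoeff k f) := by
  obtain ⟨f, rfl⟩ := Ideal.Quotient.mk_surjective f
  have h0 : PowerSeries.coeff k.1 (PowerSeries.map (φ : A →+* B) f)
      = φ (PowerSeries.coeff k.1 f) := by
    rw [PowerSeries.coeff_map]; rfl
  exact h0

theorem jmap_jmk {m : ℕ∞} {A B : Type*} [CommRing A] [CommRing B] [Algebra ℂ A] [Algebra ℂ B]
    (φ : A →ₐ[ℂ] B) (c : JetIdx m → A) : jmap m φ (jmk c) = jmk fun k => φ (c k) := by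
  apply JetRing.ext
  intro k
  rw [jcoeff_jmap, jcoeff_jmk, jcoeff_jmk]

/-! ## The jet algebra `𝒪(X_m)` of `X = Spec R` -/

section JetAlg

variable (m : ℕ∞) (R : Type*) [CommRing R] [Algebra ℂ R]

/-- The universal family `r(t) = ∑_{k ≤ m} r_k t ^ k` with indeterminate coefficients `r_k`. -/
def genJet (r : R) : JetRing m (MvPolynomial (R × JetIdx m) ℂ) :=
  jmk fun k => MvPolynomial.X (r, k)

/-- The relations which say that `r ↦ r(t)` is a homomorphism of `ℂ`-algebras. -/
def jetRelations : Set (MvPolynomial (R × JetIdx m) ℂ) :=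
  {f | ∃ (r s : R) (k : JetIdx m),
      f = jcoeff k (genJet m R (r + s) - (genJet m R r + genJet m R s))} ∪
  {f | ∃ (r s : R) (k : JetIdx m),
      f = jcoeff k (genJet m R (r * s) - genJet m R r * genJet m R s)} ∪
  {f | ∃ (c : ℂ) (k : JetIdx m),
      f = jcoeff k (genJet m R (algebraMap ℂ R c) - algebraMap ℂ _ c)}

/-- The coordinate ring of the `m`-th jet scheme (arc space for `m = ⊤`) of `Spec R`.
It represents `A ↦ Hom(R, A[t]/(t ^ (m + 1)))`, see `JetAlg.homEquiv`. -/
def JetAlg : Type _ :=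
  MvPolynomial (R × JetIdx m) ℂ ⧸ Ideal.span (jetRelations m R)

instance : CommRing (JetAlg m R) :=
  inferInstanceAs (CommRing (MvPolynomial (R × JetIdx m) ℂ ⧸ Ideal.span (jetRelations m R)))

instance : Algebra ℂ (JetAlg m R) :=
  inferInstanceAs (Algebra ℂ (MvPolynomial (R × JetIdx m) ℂ ⧸ Ideal.span (jetRelations m R)))

/-- The quotient map from the free algebra. -/
def JetAlg.proj : MvPolynomial (R × JetIdx m) ℂ →ₐ[ℂ] JetAlg m R :=
  Ideal.Quotient.mkₐ ℂ (Ideal.span (jetRelations m R))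

theorem JetAlg.proj_rel {f : MvPolynomial (R × JetIdx m) ℂ} (hf : f ∈ jetRelations m R) :
    JetAlg.proj m R f = 0 :=
  Ideal.Quotient.eq_zero_iff_mem.mpr (Ideal.subset_span hf)

/-- The universal jet `R → 𝒪(X_m)[t]/(t ^ (m + 1))`. -/
def JetAlg.univ : R →ₐ[ℂ] JetRing m (JetAlg m R) where
  toFun r := jmap m (JetAlg.proj m R) (genJet m R r)
  map_one' := by
    apply JetRing.ext; intro k
    have h := JetAlg.proj_rel m R (Or.inr ⟨1, k, rfl⟩)
    rw [← jcoeff_jmap, map_sub, map_sub, sub_eq_zero, AlgHom.commutes] at h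
    simpa using h
  map_zero' := by
    apply JetRing.ext; intro k
    have h := JetAlg.proj_rel m R (Or.inr ⟨0, k, rfl⟩)
    rw [← jcoeff_jmap, map_sub, map_sub, sub_eq_zero, AlgHom.commutes] at h
    simpa using h
  map_add' r s := by
    apply JetRing.ext; intro k
    have h := JetAlg.proj_rel m R (Or.inl (Or.inl ⟨r, s, k, rfl⟩))
    rw [← jcoeff_jmap, map_sub, map_sub, sub_eq_zero, map_add (jmap m _)] at h
    exact h
  map_mul' r s := by
    apply JetRing.ext; intro k
    have h := JetAlg.proj_rel m R (Or.inl (Or.inr ⟨r, s, k, rfl⟩))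
    rw [← jcoeff_jmap, map_sub, map_sub, sub_eq_zero, map_mul (jmap m _)] at h
    exact h
  commutes' c := by
    apply JetRing.ext; intro k
    have h := JetAlg.proj_rel m R (Or.inr ⟨c, k, rfl⟩)
    rw [← jcoeff_jmap, map_sub, map_sub, sub_eq_zero, AlgHom.commutes] at h
    exact h

variable {m R} {A : Type*} [CommRing A] [Algebra ℂ A]

/-- The homomorphism `𝒪(X_m) → A` that corresponds to `φ : R → A[t]/(t ^ (m + 1))`; it sends the
`k`-th coefficient of `r(t)` to the `k`-th coefficient of `φ r`. -/
def JetAlg.lift (φ : R →ₐ[ℂ] JetRing m A) : JetAlg m R →ₐ[ℂ] A :=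
  Ideal.Quotient.liftₐ (Ideal.span (jetRelations m R))
    (MvPolynomial.aeval fun p : R × JetIdx m => jcoeff p.2 (φ p.1)) (by
      have key : ∀ r : R, jmap m (MvPolynomial.aeval
          fun p : R × JetIdx m => jcoeff p.2 (φ p.1)) (genJet m R r) = φ r := by
        intro r
        apply JetRing.ext
        intro k
        rw [genJet, jmap_jmk, jcoeff_jmk, MvPolynomial.aeval_X]
      intro f hf
      induction hf using Submodule.span_induction with
      | mem f hf =>
        rcases hf with (⟨r, s, k, rfl⟩ | ⟨r, s, k, rfl⟩) | ⟨c, k, rfl⟩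
        · rw [← jcoeff_jmap, map_sub, map_add, key, key, key, map_add, sub_self, map_zero]
        · rw [← jcoeff_jmap, map_sub, map_mul, key, key, key, map_mul, sub_self, map_zero]
        · rw [← jcoeff_jmap, map_sub, key, AlgHom.commutes, AlgHom.commutes, sub_self, map_zero]
      | zero => exact map_zero _
      | add f g _ _ hf hg => rw [map_add, hf, hg, add_zero]
      | smul c f _ hf => rw [smul_eq_mul, map_mul, hf, mul_zero])

theorem JetAlg.lift_proj (φ : R →ₐ[ℂ] JetRing m A) (r : R) (k : JetIdx m) :
    JetAlg.lift φ (JetAlg.proj m R (MvPolynomial.X (r, k))) = jcoeff k (φ r) := by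
  have h : JetAlg.lift φ (JetAlg.proj m R (MvPolynomial.X (r, k))) =
      MvPolynomial.aeval (fun p : R × JetIdx m => jcoeff p.2 (φ p.1))
        (MvPolynomial.X (r, k) : MvPolynomial (R × JetIdx m) ℂ) := rfl
  rw [h, MvPolynomial.aeval_X]

theorem JetAlg.jcoeff_univ (r : R) (k : JetIdx m) :
    jcoeff k (JetAlg.univ m R r) = JetAlg.proj m R (MvPolynomial.X (r, k)) := by
  have h : JetAlg.univ m R r = jmap m (JetAlg.proj m R) (genJet m R r) := rfl
  rw [h, jcoeff_jmap, genJet, jcoeff_jmk]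

theorem JetAlg.hom_ext {f g : JetAlg m R →ₐ[ℂ] A}
    (h : ∀ (r : R) (k : JetIdx m), f (JetAlg.proj m R (MvPolynomial.X (r, k))) =
      g (JetAlg.proj m R (MvPolynomial.X (r, k)))) : f = g := by
  have h2 : f.comp (JetAlg.proj m R) = g.comp (JetAlg.proj m R) :=
    MvPolynomial.algHom_ext fun p => h p.1 p.2
  apply AlgHom.ext
  intro x
  obtain ⟨x, rfl⟩ : ∃ y, JetAlg.proj m R y = x := Ideal.Quotient.mk_surjective x
  exact DFunLike.congr_fun h2 x

/-- The defining property of the jet scheme: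
`Hom(𝒪(X_m), A) ≃ Hom(R, A[t]/(t ^ (m + 1)))`. -/
def JetAlg.homEquiv : (JetAlg m R →ₐ[ℂ] A) ≃ (R →ₐ[ℂ] JetRing m A) where
  toFun f := (jmap m f).comp (JetAlg.univ m R)
  invFun φ := JetAlg.lift φ
  left_inv f := by
    apply JetAlg.hom_ext
    intro r k
    rw [JetAlg.lift_proj, AlgHom.comp_apply, jcoeff_jmap, JetAlg.jcoeff_univ]
  right_inv φ := by
    apply AlgHom.ext
    intro r
    apply JetRing.ext
    intro k
    rw [AlgHom.comp_apply, jcoeff_jmap, JetAlg.jcoeff_univ, JetAlg.lift_proj]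

theorem JetAlg.comp_lift {B : Type*} [CommRing B] [Algebra ℂ B] (ψ : A →ₐ[ℂ] B)
    (φ : R →ₐ[ℂ] JetRing m A) :
    ψ.comp (JetAlg.lift φ) = JetAlg.lift ((jmap m ψ).comp φ) := by
  apply JetAlg.hom_ext
  intro r k
  rw [AlgHom.comp_apply, JetAlg.lift_proj, JetAlg.lift_proj, AlgHom.comp_apply, jcoeff_jmap]

end JetAlg

/-! ## The representation of `ℂˣ` with weights `w` and its quotient

`V = ι → ℂ`, and `t : ℂˣ` multiplies the `i`-th coordinate by `t ^ w i`. -/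

section Rep

variable {ι : Type*} (w : ι → ℤ)

/-- The action of `t : ℂˣ` on `𝒪(V)`: `f ↦ f (t • -)`. -/
def act (t : ℂˣ) : MvPolynomial ι ℂ →ₐ[ℂ] MvPolynomial ι ℂ :=
  MvPolynomial.aeval fun i => MvPolynomial.C ((t ^ w i : ℂˣ) : ℂ) * MvPolynomial.X i

/-- The invariant ring `𝒪(V)^G = 𝒪(Z)`, `G = ℂˣ`, `Z = V // G`. -/
def invRing : Subalgebra ℂ (MvPolynomial ι ℂ) :=
  ⨅ t : ℂˣ, AlgHom.equalizer (act w t) (AlgHom.id ℂ _)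

/-- The quotient map `p : V → Z` on (closed) points; a point of `Z` is a homomorphism
`𝒪(Z) → ℂ`. -/
def quotMap (v : ι → ℂ) : invRing w →ₐ[ℂ] ℂ :=
  (MvPolynomial.aeval v : MvPolynomial ι ℂ →ₐ[ℂ] ℂ).comp (invRing w).val

/-- The rank of the differential `dp` at `v`: the dimension of the span of the differentials at `v`
of the invariants. -/
def rankAt (v : ι → ℂ) : ℕ :=
  Module.finrank ℂ (Submodule.span ℂ (Set.range fun q : invRing w =>
    (fun i => MvPolynomial.eval v (MvPolynomial.pderiv i (q : MvPolynomial ι ℂ)) : ι → ℂ)))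

/-- `V'`, the set of points of `V` where `dp` has maximal rank. -/
def maxRankLocus : Set (ι → ℂ) :=
  {v | ∀ u, rankAt w u ≤ rankAt w v}

/-- `Z' = p (V')`. -/
def maxRankImage : Set (invRing w →ₐ[ℂ] ℂ) :=
  quotMap w '' maxRankLocus w

/-! ## Jets of the representation -/

/-- `𝒪(V_m) = ℂ[x_{i,k}]`, `k ≤ m`; the variable `(i, k)` is the coefficient of `t ^ k` in the
`i`-th coordinate of a jet. -/
abbrev VJet (ι : Type*) (m : ℕ∞) : Type _ := MvPolynomial (ι × JetIdx m) ℂ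

/-- The `i`-th coordinate `x_i(t) = ∑_{k ≤ m} x_{i,k} t ^ k` of the universal jet in `V`. -/
def coordJet (m : ℕ∞) (i : ι) : JetRing m (VJet ι m) :=
  jmk fun k => MvPolynomial.X (i, k)

/-- The universal jet in `V`: `f ↦ f(x(t))`. -/
def univJet (ι : Type*) (m : ℕ∞) : MvPolynomial ι ℂ →ₐ[ℂ] JetRing m (VJet ι m) :=
  MvPolynomial.aeval (coordJet m)

/-- The group `G_m = (ℂ[t]/(t ^ (m + 1)))ˣ` of `m`-jets in `G = ℂˣ`. -/
abbrev GJet (m : ℕ∞) : Type := (JetRing m ℂ)ˣ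

/-- The action of `g ∈ G_m` on `𝒪(V_m)`, given by `x_i(t) ↦ g(t) ^ w i * x_i(t)`. -/
def jetAct (m : ℕ∞) (g : GJet m) : VJet ι m →ₐ[ℂ] VJet ι m :=
  MvPolynomial.aeval fun p : ι × JetIdx m =>
    jcoeff p.2 (jmap m (Algebra.ofId ℂ (VJet ι m)) ((g ^ w p.1 : GJet m) : JetRing m ℂ)
      * coordJet m p.1)

/-- `𝒪(V_m)^{G_m}`. -/
def jetInv (m : ℕ∞) : Subalgebra ℂ (VJet ι m) :=
  ⨅ g : GJet m, AlgHom.equalizer (jetAct w m g) (AlgHom.id ℂ _)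

theorem mem_invRing {q : MvPolynomial ι ℂ} : q ∈ invRing w ↔ ∀ t : ℂˣ, act w t q = q := by
  simp [invRing, Algebra.mem_iInf, AlgHom.mem_equalizer]

theorem mem_jetInv {m : ℕ∞} {f : VJet ι m} :
    f ∈ jetInv w m ↔ ∀ g : GJet m, jetAct w m g f = f := by
  simp [jetInv, Algebra.mem_iInf, AlgHom.mem_equalizer]

theorem zpow_finset_sum {G : Type*} [CommGroup G] (g : G) (s : Finset ι) (b : ι → ℤ) :
    g ^ (∑ i ∈ s, b i) = ∏ i ∈ s, g ^ b i := by
  classical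
  induction s using Finset.induction_on with
  | empty => simp
  | insert i s hi ih => rw [Finset.sum_insert hi, Finset.prod_insert hi, zpow_add, ih]

theorem act_monomial (t : ℂˣ) (a : ι →₀ ℕ) (c : ℂ) :
    act w t (MvPolynomial.monomial a c) =
      MvPolynomial.monomial a (((t ^ (a.sum fun i n => (n : ℤ) * w i) : ℂˣ) : ℂ) * c) := by
  have h : ((t ^ (a.sum fun i n => (n : ℤ) * w i) : ℂˣ) : ℂ) =
      a.prod fun i n => ((t ^ w i : ℂˣ) : ℂ) ^ n := by
    rw [Finsupp.sum, Finsupp.prod, zpow_finset_sum, Units.coe_prod]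
    refine Finset.prod_congr rfl fun i _ => ?_
    rw [mul_comm, zpow_mul, zpow_natCast, Units.val_pow_eq_pow_val]
  rw [act, MvPolynomial.aeval_monomial, h, MvPolynomial.monomial_eq (s := a), map_mul,
    MvPolynomial.algebraMap_eq, Finsupp.prod, Finsupp.prod, Finsupp.prod, map_prod]
  simp only [mul_pow, Finset.prod_mul_distrib, map_pow]
  ring

/-- Every monomial of an invariant has weight zero. -/
theorem weight_eq_zero {q : MvPolynomial ι ℂ} (hq : q ∈ invRing w) {a : ι →₀ ℕ}
    (ha : a ∈ q.support) : (a.sum fun i n => (n : ℤ) * w i) = 0 := by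
  classical
  have h2 := (mem_invRing w).mp hq (Units.mk0 2 two_ne_zero)
  have h3 : MvPolynomial.coeff a (act w (Units.mk0 2 two_ne_zero) q) =
      (((Units.mk0 (2 : ℂ) two_ne_zero) ^ (a.sum fun i n => (n : ℤ) * w i) : ℂˣ) : ℂ) *
        MvPolynomial.coeff a q := by
    conv_lhs => rw [q.as_sum, map_sum, MvPolynomial.coeff_sum]
    simp only [act_monomial, MvPolynomial.coeff_monomial]
    rw [Finset.sum_ite_eq' q.support a, if_pos ha]
  rw [h2] at h3
  have h4 := mul_right_cancel₀ (MvPolynomial.mem_support_iff.mp ha)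
    ((one_mul _).trans h3)
  rw [Units.val_zpow_eq_zpow_val, Units.val_mk0] at h4
  have h5 : ((2 : ℝ) ^ (a.sum fun i n => (n : ℤ) * w i)) = 1 := by
    have h6 := congrArg norm h4
    rw [norm_one, norm_zpow, Complex.norm_ofNat] at h6
    exact h6.symm
  exact (zpow_eq_one_iff_right₀ (by norm_num) (by norm_num)).mp h5

theorem jmap_jetAct_coordJet (m : ℕ∞) (g : GJet m) (i : ι) :
    jmap m (jetAct w m g) (coordJet m i) =
      jmap m (Algebra.ofId ℂ (VJet ι m)) ((g ^ w i : GJet m) : JetRing m ℂ) * coordJet m i := by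
  apply JetRing.ext
  intro k
  rw [jcoeff_jmap, coordJet, jcoeff_jmk, jetAct, MvPolynomial.aeval_X]
  rfl

theorem jmap_jetAct (m : ℕ∞) (g : GJet m) (q : invRing w) :
    jmap m (jetAct w m g) (univJet ι m q) = univJet ι m q := by
  obtain ⟨q, hq⟩ := q
  change jmap m (jetAct w m g) (univJet ι m q) = univJet ι m q
  conv_lhs => rw [q.as_sum]
  conv_rhs => rw [q.as_sum]
  simp only [map_sum]
  refine Finset.sum_congr rfl fun a ha => ?_
  have hw := weight_eq_zero w hq ha
  have h1 : (a.prod fun i n => (jmap m (Algebra.ofId ℂ (VJet ι m))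
      ((g ^ w i : GJet m) : JetRing m ℂ)) ^ n) = 1 := by
    have h0 : (a.prod fun i n => (((g ^ w i : GJet m) : JetRing m ℂ)) ^ n) = 1 := by
      have : ((g ^ (a.sum fun i n => (n : ℤ) * w i) : GJet m) : JetRing m ℂ) =
          a.prod fun i n => ((g ^ w i : GJet m) : JetRing m ℂ) ^ n := by
        rw [Finsupp.sum, Finsupp.prod]
        refine (congrArg Units.val (zpow_finset_sum g _ _)).trans ?_
        rw [Units.coe_prod]
        refine Finset.prod_congr rfl fun i _ => ?_
        rw [mul_comm, zpow_mul, zpow_natCast, Units.val_pow_eq_pow_val]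
      rw [← this, hw, zpow_zero, Units.val_one]
    have h2 := congrArg (jmap m (Algebra.ofId ℂ (VJet ι m))) h0
    rw [map_one, Finsupp.prod, map_prod] at h2
    simpa only [map_pow, Finsupp.prod] using h2
  rw [univJet, MvPolynomial.aeval_monomial, map_mul, AlgHom.commutes, Finsupp.prod, map_prod]
  simp only [map_pow, jmap_jetAct_coordJet, mul_pow, Finset.prod_mul_distrib]
  rw [Finsupp.prod] at h1
  rw [h1, one_mul]

/-- `p_m^*` as a map to `𝒪(V_m)`: the map on jets induced by `𝒪(Z) ⊆ 𝒪(V)`. -/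
def pStarAux (m : ℕ∞) : JetAlg m (invRing w) →ₐ[ℂ] VJet ι m :=
  JetAlg.lift ((univJet ι m).comp (invRing w).val)

/-- `p_m^* : 𝒪(Z_m) → 𝒪(V_m)^{G_m}`. -/
def pStar (m : ℕ∞) : JetAlg m (invRing w) →ₐ[ℂ] jetInv w m :=
  (pStarAux w m).codRestrict (jetInv w m) (by
    intro x
    rw [mem_jetInv]
    intro g
    have h : (jetAct w m g).comp (pStarAux w m) = pStarAux w m := by
      rw [pStarAux, JetAlg.comp_lift]
      congr 1
      apply AlgHom.ext
      intro q
      exact jmap_jetAct w m g q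
    exact DFunLike.congr_fun h x)

/-! ## Elements of `𝒪(V_∞)` -/

/-- The coordinate function `x_i` on `V`, in `𝒪(V) ⊆ 𝒪(V_∞)`. -/
def arcX (i : ι) : VJet ι ⊤ := MvPolynomial.X (i, ⟨0, le_top⟩)

/-- The derivation `D = d/dt` of `𝒪(V_∞)`; since `x_{i,k}` is a power series coefficient,
`D ^ k x_i = k! x_{i,k}`. -/
def arcD (ι : Type*) : Derivation ℂ (VJet ι ⊤) (VJet ι ⊤) :=
  MvPolynomial.mkDerivation ℂ fun p : ι × JetIdx ⊤ =>
    ((p.2.1 + 1 : ℕ) : VJet ι ⊤) * MvPolynomial.X (p.1, ⟨p.2.1 + 1, le_top⟩)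

/-! ## The two cases -/

/-- There is exactly one positive weight, and it is `1`, or exactly one negative weight, and it is
`-1` (with multiplicity). -/
def CaseOne : Prop :=
  (∃ i, w i = 1 ∧ ∀ j, 0 < w j → j = i) ∨ (∃ i, w i = -1 ∧ ∀ j, w j < 0 → j = i)

/-- All nonzero weights are `1` or `-1`. -/
def CaseTwo : Prop := ∀ i, w i ≠ 0 → w i = 1 ∨ w i = -1

/-- The weights at `i` and `j` are `r ≥ 2` and `-s ≤ -2`. -/
def BadPair (i j : ι) : Prop := 2 ≤ w i ∧ w j ≤ -2

/-- Up to a common sign, the weights at `i₁ ≠ i₂` and `j` are `1`, `1` and `-s` with `s ≥ 2`. -/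
def BadTriple (i₁ i₂ j : ι) (s : ℕ) : Prop :=
  i₁ ≠ i₂ ∧ 2 ≤ s ∧
    ((w i₁ = 1 ∧ w i₂ = 1 ∧ w j = -(s : ℤ)) ∨ (w i₁ = -1 ∧ w i₂ = -1 ∧ w j = (s : ℤ)))

/-- `f ∈ 𝒪(V_∞)` is invariant under `G_∞`, but it is not pulled back from `Z_∞`. -/
def IsNewInvariant (f : VJet ι ⊤) : Prop :=
  ∃ h : f ∈ jetInv w ⊤, (⟨f, h⟩ : jetInv w ⊤) ∉ Set.range (pStar w ⊤)

end Rep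

end ArcInv

end

/-! Case (1). Let `i₀` carry the only weight of its sign, equal to `1` or `-1`. The affine slice
`x_{i₀} = 1` meets each orbit with `x_{i₀} ≠ 0` in exactly one point. The other weights have the
opposite sign or vanish, so the coordinates of that point are the polynomials `x_i x_{i₀} ^ |w_i|`.
Hence restriction to the slice inverts the passage to invariants, and the same formulas work for
jets, because a jet with nonzero constant term is a unit. This gives `IsSlice.bijective_pStar`, and
with the chain rule also `IsSlice.maxRankImage_eq`.

New invariants. Each is a fraction of pulled-back functions that happens to be a polynomial, hence
it is invariant. It is not pulled back, because two arcs in `V` with coefficients in a ring with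
nilpotents have the same image in `Z_∞` but give it different values
(`isNewInvariant_of_evalJet_ne`). `BadTriple.isNewInvariant` treats the Wronskians and
`isNewInvariant_logSq` the functions `(Dq)² / q`.

Case (2). By Taylor's formula an invariant is a sum of multilinear pieces. For fixed components `c
1, …, c N`, such a piece is a linear form on polynomials in `X 1, …, X N`, where `X s ^ k` stands
for the arc `t ^ k` in component `c s`. Invariance under `θ - t` for all `θ ≠ 0` says that the form
kills the ideal generated by the differences of the elementary symmetric functions in the variables
of weight `1` and of weight `-1` (`polarForm_eq_zero`). This ideal is exactly the ideal of the union
of the graphs of all bijections between the two sets of variables (`mem_symmIdeal_of_rename`).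
Dually, the forms that kill it come from products of jets of the invariants `x_i x_j` with weights
`1, -1` and `x_i` with weight `0`, which are pulled back (`sum_polarForm_mem_range`).

If neither case holds, an elementary argument on weights yields a bad pair or a bad triple, hence a
new invariant. -/

noncomputable section

namespace ArcInv

open MvPolynomial

/-! ### Points of the jet schemes, and a criterion for new invariants -/

section EvalJet

variable {ι : Type*} (w : ι → ℤ) {m : ℕ∞} {B : Type*} [CommRing B] [Algebra ℂ B]

/-- Evaluation of functions on `V_m` at a `B`-valued point of `V_m`, that is, at a tuple of
truncated power series over `B`. -/
def evalJet (y : ι → JetRing m B) : VJet ι m →ₐ[ℂ] B :=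
  aeval fun p => jcoeff p.2 (y p.1)

theorem evalJet_X (y : ι → JetRing m B) (p : ι × JetIdx m) :
    evalJet y (X p) = jcoeff p.2 (y p.1) := aeval_X _ _

theorem jmap_evalJet_coordJet (y : ι → JetRing m B) (i : ι) :
    jmap m (evalJet y) (coordJet m i) = y i := by
  apply JetRing.ext
  intro k
  rw [jcoeff_jmap, coordJet, jcoeff_jmk, evalJet_X]

theorem jmap_evalJet_univJet (y : ι → JetRing m B) (q : MvPolynomial ι ℂ) :
    jmap m (evalJet y) (univJet ι m q) = aeval y q := by
  have h : (jmap m (evalJet y)).comp (univJet ι m) = aeval y := by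
    apply MvPolynomial.algHom_ext
    intro i
    rw [AlgHom.comp_apply, univJet, aeval_X, aeval_X, jmap_evalJet_coordJet]
  exact DFunLike.congr_fun h q

theorem jmap_jmap {A C : Type*} [CommRing A] [Algebra ℂ A] [CommRing C] [Algebra ℂ C]
    (φ : A →ₐ[ℂ] B) (ψ : B →ₐ[ℂ] C) (f : JetRing m A) :
    jmap m ψ (jmap m φ f) = jmap m (ψ.comp φ) f := by
  apply JetRing.ext
  intro k
  simp only [jcoeff_jmap, AlgHom.comp_apply]

/-- The action of `G_m` on `B`-valued points of `V_m`. -/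
def smulJet (g : GJet m) (y : ι → JetRing m B) : ι → JetRing m B := fun i =>
  jmap m (Algebra.ofId ℂ B) ((g ^ w i : GJet m) : JetRing m ℂ) * y i

theorem evalJet_jetAct (g : GJet m) (y : ι → JetRing m B) (f : VJet ι m) :
    evalJet y (jetAct w m g f) = evalJet (smulJet w g y) f := by
  have h : (evalJet y).comp (jetAct w m g) = evalJet (smulJet w g y) := by
    apply MvPolynomial.algHom_ext
    rintro ⟨i, k⟩
    rw [AlgHom.comp_apply, jetAct, aeval_X, evalJet_X, ← jcoeff_jmap, map_mul,
      jmap_evalJet_coordJet, jmap_jmap]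
    have : (evalJet y).comp (Algebra.ofId ℂ (VJet ι m)) = Algebra.ofId ℂ B :=
      Subsingleton.elim _ _
    rw [this]
    rfl
  exact DFunLike.congr_fun h f

theorem evalJet_smulJet {f : VJet ι m} (hf : f ∈ jetInv w m) (g : GJet m)
    (y : ι → JetRing m B) : evalJet (smulJet w g y) f = evalJet y f := by
  rw [← evalJet_jetAct, (mem_jetInv w).mp hf]

theorem jmap_ofId (f : JetRing m ℂ) : jmap m (Algebra.ofId ℂ ℂ) f = f := by
  apply JetRing.ext
  intro k
  rw [jcoeff_jmap]
  rfl

/-- The field `ℂ` is infinite, and every complex point of `V_m` is a tuple of jets. -/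
theorem eq_of_evalJet_eq {f f' : VJet ι m}
    (h : ∀ y : ι → JetRing m ℂ, evalJet y f = evalJet y f') : f = f' := by
  apply MvPolynomial.funext
  intro v
  have h1 := h fun i => jmk fun k => v (i, k)
  have h2 : (fun p : ι × JetIdx m => jcoeff p.2 ((fun i => jmk fun k => v (i, k)) p.1)) = v := by
    ext p
    simp only [jcoeff_jmk]
  rw [evalJet, h2] at h1
  simpa [MvPolynomial.aeval_eq_eval] using h1

theorem pStarAux_proj (q : invRing w) (k : JetIdx m) :
    pStarAux w m (JetAlg.proj m _ (X (q, k))) = jcoeff k (univJet ι m q) := by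
  rw [pStarAux, JetAlg.lift_proj]
  rfl

theorem jcoeff_univJet_mem_range {q : MvPolynomial ι ℂ} (hq : q ∈ invRing w) (k : JetIdx m) :
    jcoeff k (univJet ι m q) ∈ (pStarAux w m).range :=
  ⟨_, pStarAux_proj w ⟨q, hq⟩ k⟩

theorem aeval_eq_of_weight_zero {A : Type*} [CommRing A] [Algebra ℂ A] {y y' : ι → A}
    (h : ∀ a : ι →₀ ℕ, (a.sum fun i n => (n : ℤ) * w i) = 0 →
      (a.prod fun i n => y i ^ n) = a.prod fun i n => y' i ^ n)
    {q : MvPolynomial ι ℂ} (hq : q ∈ invRing w) : aeval y q = aeval y' q := by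
  rw [q.as_sum, map_sum, map_sum]
  refine Finset.sum_congr rfl fun a ha => ?_
  rw [aeval_monomial, aeval_monomial, h a (weight_eq_zero w hq ha)]

/-- Two points of `V_m` with the same image in `Z_m` cannot be told apart by the image of
`p_m^*`. -/
theorem evalJet_pStarAux_eq {y y' : ι → JetRing m B}
    (h : ∀ q ∈ invRing w, aeval y q = aeval y' q) (x : JetAlg m (invRing w)) :
    evalJet y (pStarAux w m x) = evalJet y' (pStarAux w m x) := by
  have h2 : (evalJet y).comp (pStarAux w m) = (evalJet y').comp (pStarAux w m) := by
    apply JetAlg.hom_ext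
    intro q k
    rw [AlgHom.comp_apply, AlgHom.comp_apply, pStarAux_proj, ← jcoeff_jmap, ← jcoeff_jmap,
      jmap_evalJet_univJet, jmap_evalJet_univJet, h q q.2]
  exact DFunLike.congr_fun h2 x

/-- Invariants are combinations of monomials of weight zero, so arcs on which these agree have the
same image in `Z_∞`. The ring `B` is arbitrary; the applications use nilpotents. -/
theorem isNewInvariant_of_evalJet_ne {f : VJet ι ⊤} (hf : f ∈ jetInv w ⊤)
    {y y' : ι → JetRing ⊤ B}
    (h : ∀ a : ι →₀ ℕ, (a.sum fun i n => (n : ℤ) * w i) = 0 →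
      (a.prod fun i n => y i ^ n) = a.prod fun i n => y' i ^ n)
    (hne : evalJet y f ≠ evalJet y' f) : IsNewInvariant w f := by
  refine ⟨hf, ?_⟩
  rintro ⟨x, hx⟩
  have h2 : pStarAux w ⊤ x = f := congrArg Subtype.val hx
  apply hne
  rw [← h2]
  exact evalJet_pStarAux_eq w (fun q hq => aeval_eq_of_weight_zero w h hq) x

theorem prod_X_mem_invRing {κ : Type*} (s : Finset κ) (c : κ → ι)
    (h : ∑ x ∈ s, w (c x) = 0) : ∏ x ∈ s, (X (c x) : MvPolynomial ι ℂ) ∈ invRing w := by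
  rw [mem_invRing]
  intro t
  have h1 : ∏ x ∈ s, ((t ^ w (c x) : ℂˣ) : ℂ) = 1 := by
    rw [← Units.coe_prod, ← zpow_finset_sum, h, zpow_zero, Units.val_one]
  simp only [act, map_prod, aeval_X, Finset.prod_mul_distrib]
  rw [← map_prod, h1, map_one, one_mul]

theorem prod_X_pow_mem_invRing (s : Finset ι) (e : ι → ℕ)
    (h : ∑ i ∈ s, (e i : ℤ) * w i = 0) :
    ∏ i ∈ s, (X i : MvPolynomial ι ℂ) ^ e i ∈ invRing w := by
  rw [mem_invRing]
  intro t
  have h1 : ∏ i ∈ s, ((t ^ w i : ℂˣ) : ℂ) ^ e i = 1 := by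
    have : ∏ i ∈ s, (t ^ w i) ^ e i = 1 := by
      rw [← zpow_zero t, ← h, zpow_finset_sum]
      refine Finset.prod_congr rfl fun i _ => ?_
      rw [mul_comm, zpow_mul, zpow_natCast]
    simpa using congrArg Units.val this
  simp only [act, map_prod, map_pow, aeval_X, mul_pow, Finset.prod_mul_distrib]
  simp only [← map_pow]
  rw [← map_prod, h1, map_one, one_mul]

end EvalJet

/-! ### Case (1): the slice `x_{i₀} = 1` -/

section CaseOne

variable {ι : Type*} (w : ι → ℤ) (i₀ : ι)

/-- `i₀` is the only weight of its sign, and it is `1` or `-1`. -/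
def IsSlice : Prop := (w i₀ = 1 ∨ w i₀ = -1) ∧ ∀ i, i ≠ i₀ → w i₀ * w i ≤ 0

variable {w} in
theorem CaseOne.exists_isSlice (h : CaseOne w) : ∃ i₀, IsSlice w i₀ := by
  rcases h with ⟨i, hi, hj⟩ | ⟨i, hi, hj⟩
  · refine ⟨i, Or.inl hi, fun j hji => ?_⟩
    have : ¬ 0 < w j := fun h => hji (hj j h)
    rw [hi]; omega
  · refine ⟨i, Or.inr hi, fun j hji => ?_⟩
    have : ¬ w j < 0 := fun h => hji (hj j h)
    rw [hi]; omega

open Classical in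
/-- The invariant `x_i x_{i₀} ^ |w_i|` for `i ≠ i₀`, and `1` for `i = i₀`. -/
def sliceCoord (i : ι) : MvPolynomial ι ℂ :=
  if i = i₀ then 1 else X i * X i₀ ^ (w i).natAbs

theorem sliceCoord_self : sliceCoord w i₀ i₀ = 1 := if_pos rfl

theorem sliceCoord_of_ne {i : ι} (h : i ≠ i₀) :
    sliceCoord w i₀ i = X i * X i₀ ^ (w i).natAbs := if_neg h

variable {w i₀}

/-- If the coordinate `i₀` of a point is `g`, then `g ^ (-w i₀)` moves the point to the slice, since
`w i₀ ^ 2 = 1`. On the other coordinates it acts by nonnegative powers of `g`, which is why the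
slice coordinates are polynomials. -/
theorem IsSlice.zpow_zpow (h : IsSlice w i₀) {G : Type*} [Group G] (g : G) {i : ι}
    (hi : i ≠ i₀) : (g ^ (-w i₀)) ^ w i = g ^ (w i).natAbs := by
  have h2 := h.2 i hi
  rw [← zpow_mul, ← zpow_natCast]
  congr 1
  rcases h.1 with h1 | h1 <;> rw [h1] at h2 ⊢ <;> omega

theorem IsSlice.zpow_zpow_self (h : IsSlice w i₀) {G : Type*} [Group G] (g : G) :
    (g ^ (-w i₀)) ^ w i₀ = g⁻¹ := by
  rw [← zpow_mul, ← zpow_neg_one]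
  congr 1
  rcases h.1 with h1 | h1 <;> rw [h1] <;> norm_num

theorem IsSlice.sliceCoord_mem (h : IsSlice w i₀) (i : ι) : sliceCoord w i₀ i ∈ invRing w := by
  by_cases hi : i = i₀
  · rw [hi, sliceCoord_self]; exact one_mem _
  · rw [sliceCoord_of_ne w i₀ hi, mem_invRing]
    intro t
    have h3 : t ^ w i * (t ^ w i₀) ^ (w i).natAbs = 1 := by
      rw [← zpow_natCast, ← zpow_mul, ← zpow_add]
      have h2 := h.2 i hi
      have : w i + w i₀ * (w i).natAbs = 0 := by
        rcases h.1 with h1 | h1 <;> rw [h1] at h2 ⊢ <;> omega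
      rw [this, zpow_zero]
    have h4 : ((t ^ w i : ℂˣ) : ℂ) * ((t ^ w i₀ : ℂˣ) : ℂ) ^ (w i).natAbs = 1 := by
      rw [← Units.val_pow_eq_pow_val, ← Units.val_mul, h3, Units.val_one]
    have h5 := congrArg (C (σ := ι)) h4
    rw [map_mul, map_pow, map_one] at h5
    rw [map_mul, map_pow, act, aeval_X, aeval_X]
    linear_combination (X i * X i₀ ^ (w i).natAbs) * h5

theorem aeval_sliceCoord_self {A : Type*} [CommRing A] [Algebra ℂ A] (y : ι → A) :
    aeval y (sliceCoord w i₀ i₀) = 1 := by rw [sliceCoord_self, map_one]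

/-- The coordinates of the point of the slice in the orbit of `y`. -/
theorem IsSlice.aeval_sliceCoord (h : IsSlice w i₀) {A : Type*} [CommRing A] [Algebra ℂ A]
    (y : ι → A) (g : Aˣ) (hg : (g : A) = y i₀) (i : ι) :
    aeval y (sliceCoord w i₀ i) = (((g ^ (-w i₀)) ^ w i : Aˣ) : A) * y i := by
  by_cases hi : i = i₀
  · rw [hi, aeval_sliceCoord_self, h.zpow_zpow_self, ← hg, Units.inv_mul]
  · rw [sliceCoord_of_ne w i₀ hi, h.zpow_zpow g hi, map_mul, map_pow, aeval_X, aeval_X,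
      Units.val_pow_eq_pow_val, hg, mul_comm]

/-- An invariant is determined by its restriction to the slice. -/
theorem IsSlice.aeval_sliceCoord_eq (h : IsSlice w i₀) {q : MvPolynomial ι ℂ}
    (hq : q ∈ invRing w) : aeval (sliceCoord w i₀) q = q := by
  -- The factor `X i₀` makes the points outside the orbit of the slice trivial; it is cancelled at
  -- the end.
  have h0 : X i₀ * aeval (sliceCoord w i₀) q = X i₀ * q := by
    apply MvPolynomial.funext
    intro v
    rw [map_mul, map_mul, eval_X]
    by_cases hv : v i₀ = 0
    · rw [hv, zero_mul, zero_mul]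
    congr 1
    have h1 := (mem_invRing w).mp hq (Units.mk0 (v i₀) hv ^ (-w i₀))
    rw [← MvPolynomial.aeval_eq_eval]
    conv_rhs => rw [← h1]
    rw [← AlgHom.comp_apply, ← AlgHom.comp_apply]
    congr 1
    apply MvPolynomial.algHom_ext
    intro i
    rw [AlgHom.comp_apply, AlgHom.comp_apply, aeval_X, act, aeval_X, map_mul, aeval_X,
      MvPolynomial.aeval_C, h.aeval_sliceCoord v (Units.mk0 (v i₀) hv) rfl]
    rfl
  exact mul_left_cancel₀ (X_ne_zero i₀) h0

theorem isUnit_of_jcoeff_zero {m : ℕ∞} (f : JetRing m ℂ)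
    (h : jcoeff ⟨0, zero_le⟩ f ≠ 0) : IsUnit f := by
  obtain ⟨f, rfl⟩ := Ideal.Quotient.mk_surjective f
  rw [jcoeff_mk] at h
  apply IsUnit.map
  rw [PowerSeries.isUnit_iff_constantCoeff]
  exact isUnit_iff_ne_zero.mpr (by rwa [← PowerSeries.coeff_zero_eq_constantCoeff_apply])

/-- The argument of `IsSlice.aeval_sliceCoord_eq` for jets: where the constant term of the
coordinate `i₀` is nonzero, this coordinate is a unit `g`, and `g ^ (-w i₀)` in `G_m` moves the jet
to the slice. -/
theorem IsSlice.evalJet_sliceCoord_eq (h : IsSlice w i₀) {m : ℕ∞} {f : VJet ι m}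
    (hf : f ∈ jetInv w m) :
    aeval (fun p : ι × JetIdx m => jcoeff p.2 (univJet ι m (sliceCoord w i₀ p.1))) f = f := by
  set Φ : VJet ι m →ₐ[ℂ] VJet ι m :=
    aeval (fun p : ι × JetIdx m => jcoeff p.2 (univJet ι m (sliceCoord w i₀ p.1))) with hΦ
  have h0 : X (i₀, ⟨0, zero_le⟩) * Φ f = X (i₀, ⟨0, zero_le⟩) * f := by
    apply eq_of_evalJet_eq
    intro y
    rw [map_mul, map_mul, evalJet_X]
    by_cases hy : jcoeff ⟨0, zero_le⟩ (y i₀) = 0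
    · rw [hy, zero_mul, zero_mul]
    congr 1
    obtain ⟨g, hg⟩ := isUnit_of_jcoeff_zero _ hy
    have h1 := evalJet_smulJet w hf (g ^ (-w i₀)) y
    rw [← h1, ← AlgHom.comp_apply]
    congr 1
    apply MvPolynomial.algHom_ext
    rintro ⟨i, k⟩
    rw [AlgHom.comp_apply, hΦ, aeval_X, ← jcoeff_jmap, jmap_evalJet_univJet, evalJet_X,
      h.aeval_sliceCoord y g hg, smulJet, jmap_ofId]
  exact mul_left_cancel₀ (X_ne_zero _) h0

/-- The map from functions on `V_m` to functions on `Z_m` which restricts functions to the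
slice. -/
def IsSlice.restrict (h : IsSlice w i₀) (m : ℕ∞) : VJet ι m →ₐ[ℂ] JetAlg m (invRing w) :=
  evalJet fun i => JetAlg.univ m (invRing w) ⟨sliceCoord w i₀ i, h.sliceCoord_mem i⟩

theorem IsSlice.aeval_sliceCoord_subtype (h : IsSlice w i₀) (q : invRing w) :
    aeval (fun i => (⟨sliceCoord w i₀ i, h.sliceCoord_mem i⟩ : invRing w))
      (q : MvPolynomial ι ℂ) = q := by
  apply Subtype.ext
  rw [← h.aeval_sliceCoord_eq q.2]
  conv_rhs => rw [h.aeval_sliceCoord_eq q.2]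
  change (invRing w).val (aeval _ (aeval _ (q : MvPolynomial ι ℂ))) = _
  rw [h.aeval_sliceCoord_eq q.2, ← AlgHom.comp_apply, MvPolynomial.comp_aeval]
  exact h.aeval_sliceCoord_eq q.2

theorem IsSlice.restrict_pStarAux (h : IsSlice w i₀) {m : ℕ∞} (x : JetAlg m (invRing w)) :
    h.restrict m (pStarAux w m x) = x := by
  have h2 : (h.restrict m).comp (pStarAux w m) = AlgHom.id ℂ _ := by
    apply JetAlg.hom_ext
    intro q k
    rw [AlgHom.comp_apply, pStarAux_proj, IsSlice.restrict, ← jcoeff_jmap, jmap_evalJet_univJet,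
      AlgHom.id_apply, ← JetAlg.jcoeff_univ]
    congr 1
    conv_rhs => rw [← h.aeval_sliceCoord_subtype q]
    rw [← AlgHom.comp_apply, MvPolynomial.comp_aeval]
  exact DFunLike.congr_fun h2 x

theorem IsSlice.pStarAux_restrict (h : IsSlice w i₀) {m : ℕ∞} {f : VJet ι m}
    (hf : f ∈ jetInv w m) : pStarAux w m (h.restrict m f) = f := by
  conv_rhs => rw [← h.evalJet_sliceCoord_eq hf]
  rw [← AlgHom.comp_apply]
  congr 1
  apply MvPolynomial.algHom_ext
  rintro ⟨i, k⟩
  rw [AlgHom.comp_apply, IsSlice.restrict, evalJet_X, aeval_X, JetAlg.jcoeff_univ, pStarAux_proj]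

theorem IsSlice.bijective_pStar (h : IsSlice w i₀) (m : ℕ∞) :
    Function.Bijective (pStar w m) := by
  constructor
  · intro x y hxy
    rw [← h.restrict_pStarAux x, ← h.restrict_pStarAux y]
    exact congrArg (h.restrict m) (congrArg Subtype.val hxy)
  · rintro ⟨f, hf⟩
    exact ⟨h.restrict m f, Subtype.ext (h.pStarAux_restrict hf)⟩

/-- The differential of `q` at `v`, as a vector of partial derivatives. -/
def gradAt (v : ι → ℂ) (q : MvPolynomial ι ℂ) : ι → ℂ := fun i => eval v (pderiv i q)

theorem gradAt_aeval [Fintype ι] (U : ι → MvPolynomial ι ℂ) (q : MvPolynomial ι ℂ) (v : ι → ℂ) :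
    gradAt v (aeval U q) =
      ∑ i, eval (fun j => eval v (U j)) (pderiv i q) • gradAt v (U i) := by
  classical
  induction q using MvPolynomial.induction_on with
  | C a => ext; simp [gradAt]
  | add p q hp hq =>
    have : gradAt v (aeval U (p + q)) = gradAt v (aeval U p) + gradAt v (aeval U q) := by
      ext; simp [gradAt]
    rw [this, hp, hq, ← Finset.sum_add_distrib]
    refine Finset.sum_congr rfl fun i _ => ?_
    rw [map_add, map_add, add_smul]
  | mul_X p j hp =>
    have h1 : gradAt v (aeval U (p * X j)) = eval v (U j) • gradAt v (aeval U p) +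
        eval v (aeval U p) • gradAt v (U j) := by
      ext; simp [gradAt]; ring
    have h2 : eval v (aeval U p) = eval (fun j => eval v (U j)) p := by
      rw [← MvPolynomial.aeval_eq_eval, ← MvPolynomial.aeval_eq_eval]
      rw [← AlgHom.comp_apply, MvPolynomial.comp_aeval]
    rw [h1, hp, h2, Finset.smul_sum]
    have h3 : ∀ i, eval (fun j => eval v (U j)) (pderiv i (p * X j)) • gradAt v (U i) =
        eval v (U j) • eval (fun j => eval v (U j)) (pderiv i p) • gradAt v (U i) +
        (if i = j then eval (fun j => eval v (U j)) p • gradAt v (U i) else 0) := by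
      intro i
      by_cases hij : i = j
      · subst hij
        simp [smul_smul, add_smul]; ring
      · simp [hij, pderiv_X_of_ne (Ne.symm hij), smul_smul]
    simp only [h3, Finset.sum_add_distrib, Finset.sum_ite_eq', Finset.mem_univ, if_true]

/-- Every point of `Z` is the image of the slice point `v` whose coordinates are its values on the
slice coordinates. By the chain rule the differentials of the slice coordinates span all
differentials of invariants; at `v` they are linearly independent apart from the zero one at `i₀`,
so the rank is maximal there. -/
theorem IsSlice.maxRankImage_eq [Fintype ι] (h : IsSlice w i₀) : maxRankImage w = Set.univ := by
  classical
  refine Set.eq_univ_of_forall fun φ => ?_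
  set v : ι → ℂ := fun i => φ ⟨sliceCoord w i₀ i, h.sliceCoord_mem i⟩ with hv
  have hv0 : v i₀ = 1 := by
    have : (⟨sliceCoord w i₀ i₀, h.sliceCoord_mem i₀⟩ : invRing w) = 1 :=
      Subtype.ext (sliceCoord_self w i₀)
    rw [hv]; simp only [this, map_one]
  refine ⟨v, ?_, ?_⟩
  · intro u
    -- `A` sends the `j`-th basis vector to the differential at `u` of the `j`-th slice coordinate,
    -- so it kills the `i₀`-th one. Since `v i₀ = 1`, the differential of the `i`-th slice
    -- coordinate at `v` is the `i`-th basis vector up to a multiple of the `i₀`-th.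
    set A : (ι → ℂ) →ₗ[ℂ] (ι → ℂ) :=
      Fintype.linearCombination ℂ fun i => gradAt u (sliceCoord w i₀ i) with hA
    have hAU : ∀ i, A (gradAt v (sliceCoord w i₀ i)) = gradAt u (sliceCoord w i₀ i) := by
      intro i
      by_cases hi : i = i₀
      · have h0 : ∀ x : ι → ℂ, gradAt x (sliceCoord w i₀ i) = 0 := by
          intro x; ext; rw [hi, sliceCoord_self]; simp [gradAt]
        rw [h0, h0, map_zero]
      · have h1 : ∀ j, gradAt v (sliceCoord w i₀ i) j • gradAt u (sliceCoord w i₀ j) =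
            if j = i then gradAt u (sliceCoord w i₀ i) else 0 := by
          intro j
          by_cases hj : j = i₀
          · have h0 : gradAt u (sliceCoord w i₀ j) = 0 := by
              ext; rw [hj, sliceCoord_self]; simp [gradAt]
            rw [h0, smul_zero, if_neg]
            rintro rfl; exact hi hj
          · by_cases hji : j = i
            · subst hji
              have : gradAt v (sliceCoord w i₀ j) j = 1 := by
                rw [sliceCoord_of_ne w i₀ hj, gradAt]
                simp [pderiv_X_of_ne (Ne.symm hj), hv0]
              rw [this, one_smul, if_pos rfl]
            · have : gradAt v (sliceCoord w i₀ i) j = 0 := by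
                rw [sliceCoord_of_ne w i₀ hi, gradAt]
                simp [pderiv_X_of_ne (Ne.symm hj), pderiv_X_of_ne (Ne.symm hji)]
              rw [this, zero_smul, if_neg hji]
        rw [hA, Fintype.linearCombination_apply]
        simp only [h1, Finset.sum_ite_eq', Finset.mem_univ, if_true]
    have hle : Submodule.span ℂ (Set.range fun q : invRing w => gradAt u q) ≤
        (Submodule.span ℂ (Set.range fun q : invRing w => gradAt v q)).map A := by
      rw [Submodule.span_le]
      rintro _ ⟨q, rfl⟩
      change gradAt u q ∈ _
      rw [← h.aeval_sliceCoord_eq q.2, gradAt_aeval]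
      refine Submodule.sum_mem _ fun i _ => Submodule.smul_mem _ _ ?_
      rw [← hAU]
      exact Submodule.mem_map_of_mem
        (Submodule.subset_span ⟨⟨sliceCoord w i₀ i, h.sliceCoord_mem i⟩, rfl⟩)
    exact (Submodule.finrank_mono hle).trans (Submodule.finrank_map_le _ _)
  · apply AlgHom.ext
    intro q
    conv_rhs => rw [← h.aeval_sliceCoord_subtype q]
    rw [← AlgHom.comp_apply, MvPolynomial.comp_aeval]
    rfl

end CaseOne

/-! ### The new invariants -/

section NewInvariants

theorem mk_X_pow_eq_zero (A : Type*) [CommRing A] (n : ℕ) :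
    (Ideal.Quotient.mk (jetIdeal (n : ℕ∞) A) PowerSeries.X) ^ (n + 1) = 0 := by
  rw [← map_pow, Ideal.Quotient.eq_zero_iff_mem]
  intro k hk
  have : k ≤ n := by exact_mod_cast hk
  rw [PowerSeries.coeff_X_pow, if_neg (by omega)]

/-- The ring `ℂ[z, u] / (z ^ (b + 1), u ^ (a + 1))`, realised as an iterated ring of jets. -/
theorem exists_biTruncated (a b : ℕ) : ∃ (B : Type) (_ : CommRing B) (_ : Algebra ℂ B) (z u : B),
    z ^ (b + 1) = 0 ∧ u ^ (a + 1) = 0 ∧ z ^ b * u ^ a ≠ 0 := by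
  refine ⟨JetRing (a : ℕ∞) (JetRing (b : ℕ∞) ℂ), inferInstance, inferInstance,
    Ideal.Quotient.mk _ (PowerSeries.C (Ideal.Quotient.mk _ PowerSeries.X)),
    Ideal.Quotient.mk _ PowerSeries.X, ?_, mk_X_pow_eq_zero _ _, ?_⟩
  · rw [← map_pow, ← map_pow, mk_X_pow_eq_zero, map_zero, map_zero]
  · intro h
    rw [← map_pow, ← map_pow, ← map_pow, ← map_pow, ← map_mul,
      Ideal.Quotient.eq_zero_iff_mem] at h
    have h1 := h a le_rfl
    rw [PowerSeries.coeff_C_mul, PowerSeries.coeff_X_pow, if_pos rfl, mul_one,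
      Ideal.Quotient.eq_zero_iff_mem] at h1
    have h2 := h1 b le_rfl
    rw [PowerSeries.coeff_X_pow, if_pos rfl] at h2
    exact one_ne_zero h2

theorem jcoeff_algebraMap {A : Type*} [CommRing A] [Algebra ℂ A] {m : ℕ∞} (k : JetIdx m) (a : ℂ) :
    jcoeff k (algebraMap ℂ (JetRing m A) a) = if k.1 = 0 then algebraMap ℂ A a else 0 := by
  have h2 : algebraMap ℂ (JetRing m A) a =
    Ideal.Quotient.mk _ (algebraMap ℂ (PowerSeries A) a) := rfl
  rw [h2, jcoeff_mk, PowerSeries.algebraMap_apply, PowerSeries.coeff_C]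

variable {ι : Type*} (w : ι → ℤ)

theorem jcoeff_zero_mul {A : Type*} [CommRing A] (f g : JetRing ⊤ A) :
    jcoeff ⟨0, le_top⟩ (f * g) = jcoeff ⟨0, le_top⟩ f * jcoeff ⟨0, le_top⟩ g := by
  obtain ⟨f, rfl⟩ := Ideal.Quotient.mk_surjective f
  obtain ⟨g, rfl⟩ := Ideal.Quotient.mk_surjective g
  rw [← map_mul, jcoeff_mk, jcoeff_mk, jcoeff_mk]
  simp

theorem jcoeff_one_mul {A : Type*} [CommRing A] (f g : JetRing ⊤ A) :
    jcoeff ⟨1, le_top⟩ (f * g) = jcoeff ⟨0, le_top⟩ f * jcoeff ⟨1, le_top⟩ g +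
      jcoeff ⟨1, le_top⟩ f * jcoeff ⟨0, le_top⟩ g := by
  obtain ⟨f, rfl⟩ := Ideal.Quotient.mk_surjective f
  obtain ⟨g, rfl⟩ := Ideal.Quotient.mk_surjective g
  rw [← map_mul]
  simp only [jcoeff_mk]
  rw [PowerSeries.coeff_mul]
  simp [Finset.Nat.antidiagonal_succ]

/-- Thus `q` and `Dq` are the first two coefficients of the jet of `q`, so both are pulled back when
`q` is invariant. -/
theorem arcD_jcoeff_zero (q : MvPolynomial ι ℂ) :
    arcD ι (jcoeff ⟨0, le_top⟩ (univJet ι ⊤ q)) = jcoeff ⟨1, le_top⟩ (univJet ι ⊤ q) := by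
  induction q using MvPolynomial.induction_on with
  | C a =>
    have : univJet ι ⊤ (C a) = algebraMap ℂ _ a := AlgHom.commutes _ a
    rw [this, jcoeff_algebraMap, jcoeff_algebraMap, if_pos rfl, if_neg one_ne_zero]
    exact Derivation.map_algebraMap _ _
  | add p q hp hq => simp only [map_add, hp, hq]
  | mul_X p j hp =>
    have h2 : univJet ι ⊤ (X j) = coordJet ⊤ j := aeval_X _ _
    rw [map_mul, jcoeff_zero_mul, jcoeff_one_mul, Derivation.leibniz, hp, h2, coordJet, jcoeff_jmk, jcoeff_jmk, arcD,
      mkDerivation_X]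
    simp only [zero_add, Nat.cast_one, one_mul, smul_eq_mul]
    ring


theorem jcoeff_zero_univJet (q : MvPolynomial ι ℂ) :
    jcoeff ⟨0, le_top⟩ (univJet ι ⊤ q) = aeval arcX q := by
  induction q using MvPolynomial.induction_on with
  | C a =>
    have : univJet ι ⊤ (C a) = algebraMap ℂ _ a := AlgHom.commutes _ a
    rw [this, jcoeff_algebraMap, if_pos rfl, MvPolynomial.aeval_C]
  | add p q hp hq => simp only [map_add, hp, hq]
  | mul_X p j hp =>
    have h2 : univJet ι ⊤ (X j) = coordJet ⊤ j := aeval_X _ _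
    rw [map_mul, jcoeff_zero_mul, hp, h2, coordJet, jcoeff_jmk, map_mul, aeval_X]
    rfl

theorem arcD_aeval_arcX (q : MvPolynomial ι ℂ) :
    arcD ι (aeval arcX q) = jcoeff ⟨1, le_top⟩ (univJet ι ⊤ q) := by
  rw [← jcoeff_zero_univJet, arcD_jcoeff_zero]

theorem jcoeff_univJet_mem_jetInv {m : ℕ∞} {q : MvPolynomial ι ℂ} (hq : q ∈ invRing w)
    (k : JetIdx m) : jcoeff k (univJet ι m q) ∈ jetInv w m := by
  obtain ⟨x, hx⟩ := jcoeff_univJet_mem_range w hq k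
  rw [← hx]
  exact (pStar w m x).2

theorem aeval_arcX_mem_jetInv {q : MvPolynomial ι ℂ} (hq : q ∈ invRing w) :
    aeval arcX q ∈ jetInv w ⊤ := by
  rw [← jcoeff_zero_univJet]; exact jcoeff_univJet_mem_jetInv w hq _

theorem arcD_aeval_arcX_mem_jetInv {q : MvPolynomial ι ℂ} (hq : q ∈ invRing w) :
    arcD ι (aeval arcX q) ∈ jetInv w ⊤ := by
  rw [arcD_aeval_arcX]; exact jcoeff_univJet_mem_jetInv w hq _

/-- `𝒪(V_m)` is a domain. This gives the invariance of fractions of pulled-back functions. -/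
theorem mem_jetInv_of_mul_mem {m : ℕ∞} {f q : VJet ι m} (hq : q ∈ jetInv w m) (hq0 : q ≠ 0)
    (hfq : f * q ∈ jetInv w m) : f ∈ jetInv w m := by
  rw [mem_jetInv] at hq hfq ⊢
  intro g
  have h := hfq g
  rw [map_mul, hq g] at h
  exact mul_right_cancel₀ hq0 h

theorem arcX_ne_zero (i : ι) : (arcX i : VJet ι ⊤) ≠ 0 := X_ne_zero _

theorem arcD_arcX (i : ι) : arcD ι (arcX i) = X (i, ⟨1, le_top⟩) := by
  rw [arcX, arcD, mkDerivation_X]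
  simp

section Evaluation

variable {B : Type*} [CommRing B] [Algebra ℂ B]

theorem evalJet_arcX (y : ι → JetRing ⊤ B) (i : ι) :
    evalJet y (arcX i) = jcoeff ⟨0, le_top⟩ (y i) := evalJet_X _ _

theorem evalJet_arcD_arcX (y : ι → JetRing ⊤ B) (i : ι) :
    evalJet y (arcD ι (arcX i)) = jcoeff ⟨1, le_top⟩ (y i) := by
  rw [arcD_arcX, evalJet_X]

end Evaluation

/-- It suffices to compare the monomials in the coordinates which do not vanish. -/
theorem prod_pow_eq_of_support {B : Type*} [CommRing B] {y y' : ι → B} (S : Finset ι)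
    (h0 : ∀ i ∉ S, y i = 0) (h0' : ∀ i ∉ S, y' i = 0)
    (h : ∀ a : ι →₀ ℕ, ∑ i ∈ S, (a i : ℤ) * w i = 0 →
      ∏ i ∈ S, y i ^ a i = ∏ i ∈ S, y' i ^ a i)
    (a : ι →₀ ℕ) (ha : (a.sum fun i n => (n : ℤ) * w i) = 0) :
    (a.prod fun i n => y i ^ n) = a.prod fun i n => y' i ^ n := by
  by_cases hs : a.support ⊆ S
  · rw [Finsupp.prod_of_support_subset _ hs _ (by simp),
      Finsupp.prod_of_support_subset _ hs _ (by simp)]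
    apply h
    rw [← ha, Finsupp.sum_of_support_subset _ hs _ (by simp)]
  · obtain ⟨i, hi, hiS⟩ := Finset.not_subset.mp hs
    have hai : a i ≠ 0 := Finsupp.mem_support_iff.mp hi
    rw [Finsupp.prod, Finsupp.prod, Finset.prod_eq_zero hi, Finset.prod_eq_zero hi]
    · rw [h0' i hiS, zero_pow hai]
    · rw [h0 i hiS, zero_pow hai]

/-- The Wronskian of `x_{i₁}` and `x_{i₂}`, made invariant. -/
theorem BadTriple.isNewInvariant {i₁ i₂ j : ι} {s : ℕ} (h : BadTriple w i₁ i₂ j s) :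
    IsNewInvariant w ((arcX i₁ * arcD ι (arcX i₂) - arcX i₂ * arcD ι (arcX i₁)) *
      arcX i₁ ^ (s - 2) * arcX j) := by
  classical
  obtain ⟨h12, hs, hw⟩ := h
  have h1j : i₁ ≠ j := by rintro rfl; omega
  have h2j : i₂ ≠ j := by rintro rfl; omega
  obtain ⟨t, rfl⟩ : ∃ t, s = t + 2 := ⟨s - 2, by omega⟩
  rw [Nat.add_sub_cancel]
  have hq0 : (X i₁ ^ (t + 2) * X j : MvPolynomial ι ℂ) ∈ invRing w := by
    have h := prod_X_pow_mem_invRing w {i₁, j} (fun i => if i = j then 1 else t + 2) (by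
      rw [Finset.sum_pair h1j]
      simp only [if_neg h1j, if_true]
      rcases hw with ⟨h1, h2, h3⟩ | ⟨h1, h2, h3⟩ <;> rw [h1, h3] <;> push_cast <;> ring)
    rw [Finset.prod_pair h1j] at h
    simpa only [if_neg h1j, if_true, pow_one] using h
  have hq1 : (X i₁ ^ (t + 1) * (X i₂ * X j) : MvPolynomial ι ℂ) ∈ invRing w := by
    have h := prod_X_pow_mem_invRing w {i₁, i₂, j} (fun i => if i = i₁ then t + 1 else 1) (by
      rw [Finset.sum_insert (by simp [h12, h1j]), Finset.sum_pair h2j]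
      simp only [if_neg h1j.symm, if_neg h12.symm, if_true]
      rcases hw with ⟨h1, h2, h3⟩ | ⟨h1, h2, h3⟩ <;> rw [h1, h2, h3] <;> push_cast <;> ring)
    rw [Finset.prod_insert (by simp [h12, h1j]), Finset.prod_pair h2j] at h
    simpa only [if_neg h1j.symm, if_neg h12.symm, if_true, pow_one] using h
  have i0 := aeval_arcX_mem_jetInv w hq0
  have i1 := aeval_arcX_mem_jetInv w hq1
  have d0 := arcD_aeval_arcX_mem_jetInv w hq0
  have d1 := arcD_aeval_arcX_mem_jetInv w hq1
  -- With `q₀ = x_{i₁} ^ s x_j` and `q₁ = x_{i₁} ^ (s - 1) x_{i₂} x_j` one has `q₁ / q₀ = x_{i₂} /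
  -- x_{i₁}`, and the invariant is `(q₀ Dq₁ - q₁ Dq₀) / q₀`.
  have hinv : (arcX i₁ * arcD ι (arcX i₂) - arcX i₂ * arcD ι (arcX i₁)) *
      arcX i₁ ^ t * arcX j ∈ jetInv w ⊤ := by
    refine mem_jetInv_of_mul_mem w i0 ?_ ?_
    · simp [arcX_ne_zero]
    · have h2 := sub_mem (mul_mem i0 d1) (mul_mem i1 d0)
      convert h2 using 1
      simp only [map_mul, map_pow, aeval_X, Derivation.leibniz, Derivation.leibniz_pow,
        smul_eq_mul, nsmul_eq_mul, Nat.add_sub_cancel]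
      have e1 : t + 2 - 1 = t + 1 := rfl
      rw [e1]
      push_cast
      ring
  -- Here `z ^ s = 0` and `u ^ 2 = 0`, with `s = t + 2`. On both arcs below the only weight-zero
  -- monomials that survive are `1` and `q₁`, and `q₁` takes the value `z ^ (s - 1) u E ^ (s - 1)`
  -- on both, wherever the factors `E` are placed. The Wronskian notices the placement: its values
  -- differ by `s z ^ (s - 1) u ≠ 0`.
  obtain ⟨B, _, _, z, u, hz, hu, hzu⟩ := exists_biTruncated 1 (t + 1)
  let con : B →+* JetRing ⊤ B := (Ideal.Quotient.mk _).comp PowerSeries.C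
  let E : JetRing ⊤ B := Ideal.Quotient.mk _ (1 + PowerSeries.X)
  set y : ι → JetRing ⊤ B := fun i =>
    if i = i₁ then con z else if i = i₂ then con u * E ^ (t + 1) else if i = j then 1 else 0
    with hy
  set y' : ι → JetRing ⊤ B := fun i =>
    if i = i₁ then con z * E else if i = i₂ then con u else if i = j then 1 else 0 with hy'
  have ev : y i₁ = con z ∧ y i₂ = con u * E ^ (t + 1) ∧ y j = 1 := by
    simp [hy, h12.symm, h1j.symm, h2j.symm]
  have ev' : y' i₁ = con z * E ∧ y' i₂ = con u ∧ y' j = 1 := by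
    simp [hy', h12.symm, h1j.symm, h2j.symm]
  apply isNewInvariant_of_evalJet_ne w hinv (y := y) (y' := y')
  · refine prod_pow_eq_of_support w {i₁, i₂, j} ?_ ?_ ?_
    · intro i hi; simp at hi; simp [hy, hi]
    · intro i hi; simp at hi; simp [hy', hi]
    · intro a ha
      rw [Finset.sum_insert (by simp [h12, h1j]), Finset.sum_insert (by simp [h2j]),
        Finset.sum_singleton] at ha
      rw [Finset.prod_insert (by simp [h12, h1j]), Finset.prod_insert (by simp [h2j]),
        Finset.prod_singleton, Finset.prod_insert (by simp [h12, h1j]),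
        Finset.prod_insert (by simp [h2j]), Finset.prod_singleton, ev.1, ev.2.1, ev.2.2,
        ev'.1, ev'.2.1, ev'.2.2, one_pow, mul_one]
      have ha2 : a i₁ + a i₂ = (t + 2) * a j := by
        zify
        rcases hw with ⟨h1, h2, h3⟩ | ⟨h1, h2, h3⟩ <;> rw [h1, h2, h3] at ha <;>
          push_cast at ha ⊢ <;> linarith
      rw [mul_pow, mul_pow, ← map_pow, ← map_pow]
      by_cases h2 : 2 ≤ a i₂
      · have : u ^ a i₂ = 0 := pow_eq_zero_of_le h2 hu
        rw [this, map_zero]; ring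
      by_cases h1 : t + 2 ≤ a i₁
      · have : z ^ a i₁ = 0 := pow_eq_zero_of_le h1 hz
        rw [this, map_zero]; ring
      have hj2 : a j < 2 := by
        by_contra hcon
        have : (t + 2) * 2 ≤ (t + 2) * a j := Nat.mul_le_mul_left _ (by omega)
        omega
      interval_cases hj : a j
      · have e1 : a i₁ = 0 := by omega
        have e2 : a i₂ = 0 := by omega
        simp [e1, e2]
      · have e2 : a i₂ = 1 := by omega
        have e1 : a i₁ = t + 1 := by omega
        rw [e1, e2]; ring
  · have hc : ∀ f : PowerSeries B, ∀ k : JetIdx ⊤, jcoeff k (Ideal.Quotient.mk (jetIdeal ⊤ B) f)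
      = PowerSeries.coeff k.1 f := fun f k => jcoeff_mk k f
    have c1 : jcoeff ⟨0, le_top⟩ (y i₁) = z ∧ jcoeff ⟨1, le_top⟩ (y i₁) = 0 := by
      rw [ev.1]; simp [con, hc, PowerSeries.coeff_C]
    have c2 : jcoeff ⟨0, le_top⟩ (y i₂) = u ∧ jcoeff ⟨1, le_top⟩ (y i₂) = (t + 1) * u := by
      rw [ev.2.1]
      simp only [con, E, RingHom.comp_apply, ← map_pow, ← map_mul, hc, PowerSeries.coeff_C_mul]
      have h1 : ∀ n : ℕ, PowerSeries.coeff 1 ((1 + PowerSeries.X : PowerSeries B) ^ n) = n := by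
        intro n
        have := PowerSeries.coeff_one_pow n (1 + PowerSeries.X : PowerSeries B)
        simpa using this
      constructor
      · simp
      · rw [h1]; push_cast; ring
    have c3 : jcoeff ⟨0, le_top⟩ (y j) = 1 := by
      rw [ev.2.2, ← map_one (Ideal.Quotient.mk _), hc]; simp
    have c1' : jcoeff ⟨0, le_top⟩ (y' i₁) = z ∧ jcoeff ⟨1, le_top⟩ (y' i₁) = z := by
      rw [ev'.1]
      simp only [con, E, RingHom.comp_apply, ← map_mul, hc, PowerSeries.coeff_C_mul]
      simp [PowerSeries.coeff_one]
    have c2' : jcoeff ⟨0, le_top⟩ (y' i₂) = u ∧ jcoeff ⟨1, le_top⟩ (y' i₂) = 0 := by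
      rw [ev'.2.1]; simp [con, hc, PowerSeries.coeff_C]
    have c3' : jcoeff ⟨0, le_top⟩ (y' j) = 1 := by
      rw [ev'.2.2, ← map_one (Ideal.Quotient.mk _), hc]; simp
    simp only [map_mul, map_sub, map_pow, evalJet_arcX, evalJet_arcD_arcX, c1, c2, c3, c1', c2',
      c3']
    intro hcon
    have h5 : ((t + 2 : ℕ) : ℂ) • (z ^ (t + 1) * u ^ 1) = 0 := by
      rw [Nat.cast_smul_eq_nsmul, nsmul_eq_mul]
      push_cast
      linear_combination hcon
    rcases smul_eq_zero.mp h5 with h6 | h6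
    · exact absurd h6 (Nat.cast_ne_zero.mpr (by omega))
    · exact hzu h6

/-- Multinomial expansion modulo `v ^ 3`, doubled to avoid dividing the binomial coefficient `(m +
1) m / 2`. -/
theorem trinomial_pow {R : Type*} [CommRing R] (z v c : R) (hv : v ^ 3 = 0) (m : ℕ) :
    2 * (z ^ 2 + z * v + c * v ^ 2) ^ (m + 1) =
      2 * z ^ (2 * m + 2) + 2 * (m + 1) * z ^ (2 * m + 1) * v +
        (m + 1) * (2 * c + m) * z ^ (2 * m) * v ^ 2 := by
  induction m with
  | zero => push_cast; ring
  | succ m ih =>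
    rw [pow_succ, ← mul_assoc, ih]
    push_cast
    linear_combination
      (2 * (m + 1) * z ^ (2 * m + 1) * c + (m + 1) * (2 * c + m) * z ^ (2 * m) * z +
        (m + 1) * (2 * c + m) * z ^ (2 * m) * c * v) * hv

/-- The choice `c = -m / 2` removes the coefficient of `z ^ (2 * m) v ^ 2`, the only term that the
relations on `z` and `v` leave alive. -/
theorem trinomial_pow_eq_zero {R : Type*} [CommRing R] [Algebra ℂ R] {z v c : R} {m : ℕ}
    (hv : v ^ 3 = 0) (hz : z ^ (2 * m + 1) = 0) (hc : 2 * c + m = 0) :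
    (z ^ 2 + z * v + c * v ^ 2) ^ (m + 1) = 0 := by
  have h := trinomial_pow z v c hv m
  have h1 : z ^ (2 * m + 2) = 0 := by rw [pow_succ, hz, zero_mul]
  rw [hc, hz, h1] at h
  have h2 : (2 : ℂ) • (z ^ 2 + z * v + c * v ^ 2) ^ (m + 1) = 0 := by
    rw [← Nat.cast_ofNat, Nat.cast_smul_eq_nsmul, nsmul_eq_mul]
    push_cast
    rw [h]; ring
  exact (smul_eq_zero.mp h2).resolve_left two_ne_zero

/-- `(Dq)² / q` is a polynomial if all exponents of the monomial `q` are at least `2`. -/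
theorem exists_mul_prod_pow_eq_sq {A κ : Type*} [CommRing A] [Algebra ℂ A]
    (D : Derivation ℂ A A) (x : κ → A) (T : Finset κ) (e : κ → ℕ) (he : ∀ i ∈ T, 2 ≤ e i) :
    ∃ f, f * ∏ i ∈ T, x i ^ e i = D (∏ i ∈ T, x i ^ e i) ^ 2 := by
  classical
  induction T using Finset.induction_on with
  | empty => exact ⟨0, by simp⟩
  | insert i T hi ih =>
    obtain ⟨f, hf⟩ := ih fun j hj => he j (Finset.mem_insert_of_mem hj)
    obtain ⟨n, hn⟩ : ∃ n, e i = n + 2 := ⟨e i - 2, by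
      have := he i (Finset.mem_insert_self i T); omega⟩
    rw [Finset.prod_insert hi, hn]
    set Q := ∏ i ∈ T, x i ^ e i
    -- The square of `D (x ^ (n + 2) Q)` expanded by Leibniz and divided by `x ^ (n + 2) Q`, with
    -- `f` in place of `(DQ)² / Q`.
    refine ⟨x i ^ n * ((n + 2) ^ 2 * D (x i) ^ 2 * Q + 2 * (n + 2) * x i * D (x i) * D Q +
      x i ^ 2 * f), ?_⟩
    simp only [Derivation.leibniz, Derivation.leibniz_pow, smul_eq_mul, nsmul_eq_mul]
    have e1 : n + 2 - 1 = n + 1 := rfl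
    rw [e1]
    push_cast
    linear_combination (x i ^ (n + 2)) ^ 2 * hf

/-- Put `x_i = 1` for `i ∈ T` and all coordinates outside `T ∪ {k}` equal to zero. By `hdvd`,
pulled-back functions see `x_k` only through `x_k ^ n`, so they cannot tell an arc `x` with `x ^ n =
0` from the zero arc. But `(Dq)² / q` becomes `n ^ 2 x ^ (n - 2) (Dx) ^ 2`, which need not vanish at
`t = 0`. -/
theorem isNewInvariant_logSq (k : ι) (T : Finset ι) (hk : k ∉ T) (n : ℕ) (hn : 2 ≤ n)
    (e : ι → ℕ) (he : ∀ i ∈ T, 2 ≤ e i)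
    (hw : (n : ℤ) * w k + ∑ i ∈ T, (e i : ℤ) * w i = 0)
    (hdvd : ∀ a : ι →₀ ℕ, (a k : ℤ) * w k + ∑ i ∈ T, (a i : ℤ) * w i = 0 → n ∣ a k) :
    ∃ f, IsNewInvariant w f ∧ f * (arcX k ^ n * ∏ i ∈ T, arcX i ^ e i) =
      arcD ι (arcX k ^ n * ∏ i ∈ T, arcX i ^ e i) ^ 2 := by
  classical
  obtain ⟨f', hf'⟩ := exists_mul_prod_pow_eq_sq (arcD ι) arcX T e he
  obtain ⟨m, rfl⟩ : ∃ m, n = m + 2 := ⟨n - 2, by omega⟩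
  have hq0 : (X k ^ (m + 2) * ∏ i ∈ T, X i ^ e i : MvPolynomial ι ℂ) ∈ invRing w := by
    have h := prod_X_pow_mem_invRing w (insert k T) (fun i => if i = k then m + 2 else e i) (by
      rw [Finset.sum_insert hk, if_pos rfl, ← hw]
      congr 1
      refine Finset.sum_congr rfl fun i hi => ?_
      rw [if_neg (by rintro rfl; exact hk hi)])
    rw [Finset.prod_insert hk, if_pos rfl] at h
    convert h using 2
    refine Finset.prod_congr rfl fun i hi => ?_
    rw [if_neg (by rintro rfl; exact hk hi)]
  have i0 := aeval_arcX_mem_jetInv w hq0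
  have d0 := arcD_aeval_arcX_mem_jetInv w hq0
  have hQ : aeval arcX (X k ^ (m + 2) * ∏ i ∈ T, X i ^ e i : MvPolynomial ι ℂ) =
      arcX k ^ (m + 2) * ∏ i ∈ T, arcX i ^ e i := by
    simp only [map_mul, map_pow, map_prod, aeval_X]
  rw [hQ] at i0 d0
  set Q := ∏ i ∈ T, (arcX i : VJet ι ⊤) ^ e i with hQdef
  set f : VJet ι ⊤ := arcX k ^ m * ((m + 2) ^ 2 * arcD ι (arcX k) ^ 2 * Q +
    2 * (m + 2) * arcX k * arcD ι (arcX k) * arcD ι Q + arcX k ^ 2 * f') with hf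
  have hfQ : f * (arcX k ^ (m + 2) * Q) = arcD ι (arcX k ^ (m + 2) * Q) ^ 2 := by
    simp only [hf, Derivation.leibniz, Derivation.leibniz_pow, smul_eq_mul, nsmul_eq_mul]
    have e1 : m + 2 - 1 = m + 1 := rfl
    rw [e1]
    push_cast
    linear_combination (arcX k ^ (m + 2)) ^ 2 * hf'
  refine ⟨f, ?_, hfQ⟩
  have hinv : f ∈ jetInv w ⊤ := by
    refine mem_jetInv_of_mul_mem w i0 ?_ (by rw [hfQ]; exact pow_mem d0 2)
    exact mul_ne_zero (pow_ne_zero _ (arcX_ne_zero k))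
      (Finset.prod_ne_zero_iff.mpr fun i _ => pow_ne_zero _ (arcX_ne_zero i))
  -- With `n = m + 2`: the arc `x = z² + z u t + c u² t²` has `x ^ n = 0` by
  -- `trinomial_pow_eq_zero`, while `x ^ (n - 2) (Dx) ^ 2` is `z ^ (2 * m + 2) u ^ 2 ≠ 0` at `t =
  -- 0`. The exponents of the truncation are the largest that allow the first.
  obtain ⟨B, _, _, z, u, hz, hu, hzu⟩ := exists_biTruncated 2 (2 * (m + 1))
  let con : B →+* JetRing ⊤ B := (Ideal.Quotient.mk _).comp PowerSeries.C
  let t : JetRing ⊤ B := Ideal.Quotient.mk _ PowerSeries.X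
  set c : B := algebraMap ℂ B (-((m + 1 : ℕ) : ℂ) / 2) with hc
  have hc2 : 2 * c + ((m + 1 : ℕ) : B) = 0 := by
    rw [hc, ← map_ofNat (algebraMap ℂ B) 2, ← map_natCast (algebraMap ℂ B), ← map_mul, ← map_add,
      ← map_zero (algebraMap ℂ B)]
    congr 1
    ring
  set x : JetRing ⊤ B := con z ^ 2 + con z * (con u * t) + con c * (con u * t) ^ 2 with hx
  have hxn : x ^ (m + 2) = 0 := by
    refine trinomial_pow_eq_zero (m := m + 1) ?_ ?_ ?_
    · rw [mul_pow, ← map_pow, hu, map_zero, zero_mul]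
    · rw [← map_pow, hz, map_zero]
    · rw [← map_natCast con, ← map_ofNat con 2, ← map_mul, ← map_add, hc2, map_zero]
  set y : ι → JetRing ⊤ B := fun i => if i = k then x else if i ∈ T then 1 else 0 with hy
  set y' : ι → JetRing ⊤ B := fun i => if i = k then 0 else if i ∈ T then 1 else 0 with hy'
  have hyk : y k = x := if_pos rfl
  have hyk' : y' k = 0 := if_pos rfl
  have hyT : ∀ i ∈ T, y i = 1 := fun i hi => by
    rw [hy]; simp only; rw [if_neg (by rintro rfl; exact hk hi), if_pos hi]
  have hyT' : ∀ i ∈ T, y' i = 1 := fun i hi => by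
    rw [hy']; simp only; rw [if_neg (by rintro rfl; exact hk hi), if_pos hi]
  have hc0 : ∀ f : PowerSeries B, ∀ k : JetIdx ⊤,
      jcoeff k (Ideal.Quotient.mk (jetIdeal ⊤ B) f) = PowerSeries.coeff k.1 f :=
    fun f k => jcoeff_mk k f
  have hone : jcoeff (m := ⊤) ⟨0, le_top⟩ (1 : JetRing ⊤ B) = 1 ∧
      jcoeff (m := ⊤) ⟨1, le_top⟩ (1 : JetRing ⊤ B) = 0 := by
    rw [← map_one (Ideal.Quotient.mk _), hc0, hc0]; simp [PowerSeries.coeff_one]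
  have hx0 : jcoeff ⟨0, le_top⟩ x = z ^ 2 ∧ jcoeff ⟨1, le_top⟩ x = z * u := by
    have hxm : x = Ideal.Quotient.mk _ (PowerSeries.C (z ^ 2) +
        PowerSeries.C (z * u) * PowerSeries.X +
        PowerSeries.C (c * u ^ 2) * PowerSeries.X ^ 2) := by
      simp only [hx, con, t, map_add, map_mul, map_pow, RingHom.comp_apply]
      ring
    rw [hxm, hc0, hc0]
    simp only [map_add, PowerSeries.coeff_C_mul, PowerSeries.coeff_C, PowerSeries.coeff_X_pow,
      PowerSeries.coeff_X]
    norm_num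
  have hev : ∀ y : ι → JetRing ⊤ B, (∀ i ∈ T, y i = 1) →
      evalJet y f = jcoeff ⟨0, le_top⟩ (y k) ^ m * ((m + 2) ^ 2 * jcoeff ⟨1, le_top⟩ (y k) ^ 2) := by
    intro y hyT
    have hy1 : aeval y (∏ i ∈ T, X i ^ e i : MvPolynomial ι ℂ) = 1 := by
      rw [map_prod]
      refine Finset.prod_eq_one fun i hi => ?_
      rw [map_pow, aeval_X, hyT i hi, one_pow]
    have hQa : aeval arcX (∏ i ∈ T, X i ^ e i : MvPolynomial ι ℂ) = Q := by
      simp only [map_pow, map_prod, aeval_X, hQdef]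
    have e0 : evalJet y Q = 1 := by
      rw [← hQa, ← jcoeff_zero_univJet, ← jcoeff_jmap, jmap_evalJet_univJet, hy1, hone.1]
    have e1 : evalJet y (arcD ι Q) = 0 := by
      rw [← hQa, arcD_aeval_arcX, ← jcoeff_jmap, jmap_evalJet_univJet, hy1, hone.2]
    have e2 : evalJet y f' = 0 := by
      have := congrArg (evalJet y) hf'
      rw [map_mul, map_pow, e0, e1] at this
      simpa using this
    simp only [hf, map_mul, map_add, map_pow, e0, e1, e2, evalJet_arcX, evalJet_arcD_arcX,
      map_natCast, map_ofNat]
    ring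
  apply isNewInvariant_of_evalJet_ne w hinv (y := y) (y' := y')
  · refine prod_pow_eq_of_support w (insert k T) ?_ ?_ ?_
    · intro i hi; simp at hi; simp [hy, hi]
    · intro i hi; simp at hi; simp [hy', hi]
    · intro a ha
      rw [Finset.sum_insert hk] at ha
      have h1 : ∀ y : ι → JetRing ⊤ B, (∀ i ∈ T, y i = 1) → ∏ i ∈ T, y i ^ a i = 1 :=
        fun y hy => Finset.prod_eq_one fun i hi => by rw [hy i hi, one_pow]
      rw [Finset.prod_insert hk, Finset.prod_insert hk, h1 y hyT, h1 y' hyT', hyk, hyk']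
      obtain ⟨d, hd⟩ := hdvd a ha
      rw [hd, pow_mul, pow_mul, hxn, zero_pow (n := m + 2) (by omega)]
  · rw [hev y hyT, hev y' hyT', hyk, hyk', hx0.1, hx0.2, map_zero, map_zero]
    intro hcon
    have h5 : (((m + 2) ^ 2 : ℕ) : ℂ) • (z ^ (2 * (m + 1)) * u ^ 2) = 0 := by
      rw [Nat.cast_smul_eq_nsmul, nsmul_eq_mul]
      push_cast
      linear_combination hcon
    rcases smul_eq_zero.mp h5 with h6 | h6
    · exact absurd h6 (Nat.cast_ne_zero.mpr (by positivity))
    · exact hzu h6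

variable {w}

/-- `isNewInvariant_logSq` with `k = i`, `T = {j}`, `n = |w j|`: in a weight-zero monomial,
coprimality forces `w j` to divide the exponent of `x_i`. -/
theorem BadPair.exists_isNewInvariant {i j : ι} (h : BadPair w i j)
    (hg : Int.gcd (w i) (w j) = 1) :
    ∃ f q, IsNewInvariant w f ∧
      q = arcX i ^ (w j).natAbs * arcX j ^ (w i).natAbs ∧ f * q = arcD ι q ^ 2 := by
  obtain ⟨hi, hj⟩ := h
  have hij : i ∉ ({j} : Finset ι) := by
    rw [Finset.mem_singleton]; rintro rfl; omega
  obtain ⟨f, hf, hq⟩ := isNewInvariant_logSq w i {j} hij (w j).natAbs (by omega)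
    (fun _ => (w i).natAbs) (fun _ _ => by omega) (by
      rw [Finset.sum_singleton, Int.natAbs_of_nonneg (by omega : 0 ≤ w i),
        Int.ofNat_natAbs_of_nonpos (by omega : w j ≤ 0)]
      ring) (by
      intro a ha
      rw [Finset.sum_singleton] at ha
      have h1 : w j ∣ (a i : ℤ) * w i := ⟨-a j, by linarith⟩
      have h2 : w j ∣ (a i : ℤ) :=
        Int.dvd_of_dvd_mul_left_of_gcd_one h1 (by rw [Int.gcd_comm]; exact hg)
      exact Int.natAbs_dvd_natAbs.mpr h2)
  rw [Finset.prod_singleton] at hq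
  exact ⟨f, _, hf, rfl, hq⟩

/-- As all weights have gcd `1`, some `w k` is not divisible by `g`. The number `n` is the least
positive one with `g ∣ n * w k`, hence it divides the exponent of `x_k` in every weight-zero
monomial in `x_k, x_i, x_j`, and `isNewInvariant_logSq` applies with `T = {i, j}`. -/
theorem BadPair.exists_isNewInvariant_of_gcd_ne_one [Fintype ι] (hgcd : Finset.univ.gcd w = 1)
    {i j : ι} (h : BadPair w i j) (hg : Int.gcd (w i) (w j) ≠ 1) :
    ∃ (k : ι) (n α β : ℕ), ¬ (Int.gcd (w i) (w j) : ℤ) ∣ w k ∧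
      n = Int.gcd (w i) (w j) / Int.gcd (Int.gcd (w i) (w j)) (w k) ∧
      2 ≤ α ∧ 2 ≤ β ∧ n * w k + α * w i + β * w j = 0 ∧
      ∃ f q, IsNewInvariant w f ∧
        q = arcX k ^ n * arcX i ^ α * arcX j ^ β ∧ f * q = arcD ι q ^ 2 := by
  classical
  obtain ⟨hi, hj⟩ := h
  set g := Int.gcd (w i) (w j) with hgdef
  have hg0 : 0 < g := Int.gcd_pos_of_ne_zero_left _ (by omega)
  have hgi : (g : ℤ) ∣ w i := Int.gcd_dvd_left _ _
  have hgj : (g : ℤ) ∣ w j := Int.gcd_dvd_right _ _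
  obtain ⟨k, hk⟩ : ∃ k, ¬ (g : ℤ) ∣ w k := by
    by_contra! hcon
    have h1 : (g : ℤ) ∣ Finset.univ.gcd w := Finset.dvd_gcd fun k _ => hcon k
    rw [hgcd] at h1
    exact hg (by exact_mod_cast Int.eq_one_of_dvd_one (by positivity) h1)
  set d := Int.gcd g (w k) with hd
  have hdpos : 0 < d := Int.gcd_pos_of_ne_zero_left _ (by omega)
  have hdg : d ∣ g := by exact_mod_cast Int.gcd_dvd_left (g : ℤ) (w k)
  have hdk : (d : ℤ) ∣ w k := Int.gcd_dvd_right (g : ℤ) (w k)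
  obtain ⟨n, hn⟩ := hdg
  have hnd : g / d = n := by rw [hn, Nat.mul_div_cancel_left _ hdpos]
  have hn2 : 2 ≤ n := by
    rcases n with _ | _ | n
    · omega
    · exfalso; apply hk
      have : g = d := by omega
      rw [this]; exact hdk
    · omega
  have hdvd : ∀ a : ℕ, (g : ℤ) ∣ a * w k → n ∣ a := by
    intro a ha
    obtain ⟨e, he⟩ := hdk
    have h1 : Int.gcd n e = 1 := by
      have h2 : Int.gcd g (w k) = d := rfl
      rw [he, hn, Nat.cast_mul, Int.gcd_mul_left] at h2
      have h3 : (d : ℤ).natAbs * Int.gcd n e = d * 1 := by rw [mul_one]; exact h2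
      exact Nat.eq_of_mul_eq_mul_left hdpos h3
    rw [he, hn] at ha
    push_cast at ha
    have h3 : (n : ℤ) ∣ a * e := by
      have : (d : ℤ) * n ∣ d * (a * e) := by convert ha using 1; ring
      exact Int.dvd_of_mul_dvd_mul_left (by omega) this
    exact_mod_cast Int.dvd_of_dvd_mul_left_of_gcd_one h3 h1
  obtain ⟨α, β, hα, hβ, hsum⟩ : ∃ α β : ℕ, 2 ≤ α ∧ 2 ≤ β ∧
      (n : ℤ) * w k + α * w i + β * w j = 0 := by
    obtain ⟨e, he⟩ := hdk
    have hb := Int.gcd_eq_gcd_ab (w i) (w j)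
    set A := Int.gcdA (w i) (w j)
    set B := Int.gcdB (w i) (w j)
    have hb2 : (n : ℤ) * w k = w i * (A * e) + w j * (B * e) := by
      have : (n : ℤ) * w k = g * e := by rw [he, hn]; push_cast; ring
      rw [this, hgdef, hb]; ring
    -- By Bézout `(-A e, -B e)` solves the equation for `(α, β)` in integers. Adding `N` times the
    -- homogeneous solution `(-w j, w i)`, whose entries are at least `2`, makes both entries at
    -- least `2`.
    set N : ℤ := |A * e| + |B * e| + 2 with hN
    have hA := abs_nonneg (A * e)
    have hB := abs_nonneg (B * e)
    have hA2 := le_abs_self (A * e)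
    have hB2 := le_abs_self (B * e)
    have h1 : 2 ≤ -(A * e) - N * w j := by nlinarith
    have h2 : 2 ≤ -(B * e) + N * w i := by nlinarith
    refine ⟨(-(A * e) - N * w j).toNat, (-(B * e) + N * w i).toNat, by omega, by omega, ?_⟩
    rw [Int.toNat_of_nonneg (by omega), Int.toNat_of_nonneg (by omega), hb2]
    ring
  refine ⟨k, n, α, β, hk, hnd.symm, hα, hβ, hsum, ?_⟩
  have hij : i ≠ j := by rintro rfl; omega
  have hkT : k ∉ ({i, j} : Finset ι) := by
    simp only [Finset.mem_insert, Finset.mem_singleton, not_or]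
    exact ⟨fun h => hk (h ▸ hgi), fun h => hk (h ▸ hgj)⟩
  obtain ⟨f, hf, hq⟩ := isNewInvariant_logSq w k {i, j} hkT n hn2
    (fun x => if x = j then β else α) (fun x _ => by split_ifs <;> assumption) (by
      rw [Finset.sum_pair hij, if_neg hij, if_pos rfl]
      linarith) (by
      intro a ha
      rw [Finset.sum_pair hij] at ha
      apply hdvd
      have h1 : (a k : ℤ) * w k = -(a i * w i + a j * w j) := by linarith
      rw [h1]
      exact (dvd_add (Dvd.dvd.mul_left hgi _) (Dvd.dvd.mul_left hgj _)).neg_right)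
  rw [Finset.prod_pair hij, if_neg hij, if_pos rfl] at hq
  exact ⟨f, _, hf, by rw [mul_assoc], hq⟩

end NewInvariants

/-! ### The ideal identifying the elementary symmetric functions of two sets of variables -/

section SymmetricIdeal

variable {τ K : Type*} [CommRing K]

/-- The difference of the monic polynomials with roots `X b`, `b ∈ B`, and `X a`, `a ∈ A`. -/
def rootsDiff (K : Type*) [CommRing K] (A B : Finset τ) : Polynomial (MvPolynomial τ K) :=
  ∏ b ∈ B, (Polynomial.X - Polynomial.C (X b)) - ∏ a ∈ A, (Polynomial.X - Polynomial.C (X a))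

/-- The ideal generated by the differences of the elementary symmetric functions of the `X a`,
`a ∈ A`, and of the `X b`, `b ∈ B`. -/
def symmIdeal (K : Type*) [CommRing K] (A B : Finset τ) : Ideal (MvPolynomial τ K) :=
  Ideal.span (Set.range fun n => (rootsDiff K A B).coeff n)

theorem symmIdeal_le_iff {A B : Finset τ} {I : Ideal (MvPolynomial τ K)} :
    symmIdeal K A B ≤ I ↔ (rootsDiff K A B).map (Ideal.Quotient.mk I) = 0 := by
  rw [symmIdeal, Ideal.span_le, Polynomial.ext_iff]
  constructor
  · intro h n
    rw [Polynomial.coeff_map, Polynomial.coeff_zero, Ideal.Quotient.eq_zero_iff_mem]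
    exact h ⟨n, rfl⟩
  · rintro h _ ⟨n, rfl⟩
    have := h n
    rwa [Polynomial.coeff_map, Polynomial.coeff_zero, Ideal.Quotient.eq_zero_iff_mem] at this

/-- The leading coefficient `±1` of the difference of monic polynomials of different degrees is a
generator. This matches the absence of bijections. -/
theorem symmIdeal_eq_top [Nontrivial K] {A B : Finset τ} (h : A.card ≠ B.card) :
    symmIdeal K A B = ⊤ := by
  rw [Ideal.eq_top_iff_one]
  have hB : ∀ A : Finset τ, (∏ b ∈ A, (Polynomial.X - Polynomial.C (X b)) :
      Polynomial (MvPolynomial τ K)).Monic := fun A =>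
    Polynomial.monic_prod_of_monic _ _ fun b _ => Polynomial.monic_X_sub_C _
  have hd : ∀ A : Finset τ, (∏ b ∈ A, (Polynomial.X - Polynomial.C (X b)) :
      Polynomial (MvPolynomial τ K)).natDegree = A.card := fun A => by
    rw [Polynomial.natDegree_prod_of_monic _ _ fun b _ => Polynomial.monic_X_sub_C _]
    simp
  rcases lt_or_gt_of_ne h with h | h
  · have : (rootsDiff K A B).coeff B.card = 1 := by
      rw [rootsDiff, Polynomial.coeff_sub, Polynomial.coeff_eq_zero_of_natDegree_lt
        ((hd A).trans_lt h), sub_zero]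
      have := (hB B).coeff_natDegree
      rwa [hd] at this
    rw [← this]
    exact Ideal.subset_span ⟨_, rfl⟩
  · have : (rootsDiff K A B).coeff A.card = -1 := by
      rw [rootsDiff, Polynomial.coeff_sub, Polynomial.coeff_eq_zero_of_natDegree_lt
        ((hd B).trans_lt h), zero_sub]
      have := (hB A).coeff_natDegree
      rw [hd] at this
      rw [this]
    rw [← neg_mem_iff, ← this]
    exact Ideal.subset_span ⟨_, rfl⟩

/-- Up to sign this is the value of `rootsDiff` at the root `X b` of its first product, and a value
is a combination of coefficients. -/
theorem prod_sub_mem_symmIdeal (A B : Finset τ) {b : τ} (hb : b ∈ B) :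
    ∏ a ∈ A, (X b - X a) ∈ symmIdeal K A B := by
  have h : ∏ a ∈ A, (X b - X a) = -(rootsDiff K A B).eval (X b) := by
    rw [rootsDiff, Polynomial.eval_sub, Polynomial.eval_prod, Polynomial.eval_prod,
      Finset.prod_eq_zero (i := b) hb (by simp)]
    simp
  rw [h, neg_mem_iff, Polynomial.eval_eq_sum, Polynomial.sum]
  exact Ideal.sum_mem _ fun n _ => Ideal.mul_mem_right _ _ (Ideal.subset_span ⟨n, rfl⟩)

/-- Modulo `X b - X a` the two products share a linear factor, which is monic and can be cancelled.
-/
theorem symmIdeal_erase_le [DecidableEq τ] {A B : Finset τ} {a b : τ} (ha : a ∈ A) (hb : b ∈ B) :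
    symmIdeal K (A.erase a) (B.erase b) ≤ symmIdeal K A B ⊔ Ideal.span {X b - X a} := by
  generalize hI : symmIdeal K A B ⊔ Ideal.span {X b - X a} = I
  have h1 := (symmIdeal_le_iff (I := I)).mp (hI ▸ le_sup_left)
  have h2 : Ideal.Quotient.mk I (X b) = Ideal.Quotient.mk I (X a) := by
    rw [← sub_eq_zero, ← map_sub, Ideal.Quotient.eq_zero_iff_mem]
    rw [← hI]
    exact le_sup_right (a := symmIdeal K A B) (Ideal.subset_span rfl)
  rw [symmIdeal_le_iff]
  rw [rootsDiff, ← Finset.mul_prod_erase _ _ ha, ← Finset.mul_prod_erase _ _ hb] at h1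
  rw [rootsDiff]
  simp only [Polynomial.map_sub, Polynomial.map_mul, Polynomial.map_X, Polynomial.map_C,
    h2, ← mul_sub] at h1 ⊢
  exact ((Polynomial.monic_X_sub_C _).mul_right_eq_zero_iff).mp h1

theorem sub_rename_update_mem [DecidableEq τ] (a b : τ) (P : MvPolynomial τ K) :
    P - rename (Function.update id b a) P ∈ Ideal.span {(X b - X a : MvPolynomial τ K)} := by
  rw [← Ideal.Quotient.mk_eq_mk_iff_sub_mem]
  have h : (Ideal.Quotient.mkₐ K (Ideal.span {(X b - X a : MvPolynomial τ K)})).comp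
      (rename (Function.update id b a)) = Ideal.Quotient.mkₐ K _ := by
    apply MvPolynomial.algHom_ext
    intro i
    rw [AlgHom.comp_apply, rename_X]
    by_cases hi : i = b
    · subst hi
      rw [Function.update_self]
      refine ((Ideal.Quotient.mk_eq_mk_iff_sub_mem _ _).mpr ?_).symm
      exact Ideal.subset_span rfl
    · rw [Function.update_of_ne hi]; rfl
  exact (DFunLike.congr_fun h P).symm

/-- The maps which identify the variables in `B` with the variables in `A` through a bijection. -/
def Gluing (A B : Finset τ) : Set (τ → τ) :=
  {θ | Set.BijOn θ B A ∧ ∀ s ∉ B, θ s = s}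

theorem rename_eq_zero_of_mem_symmIdeal {A B : Finset τ} (hAB : Disjoint A B) {θ : τ → τ}
    (hθ : θ ∈ Gluing A B) {P : MvPolynomial τ K} (hP : P ∈ symmIdeal K A B) :
    rename θ P = 0 := by
  have h : symmIdeal K A B ≤ RingHom.ker (rename (R := K) θ).toRingHom := by
    rw [symmIdeal, Ideal.span_le]
    rintro _ ⟨n, rfl⟩
    rw [SetLike.mem_coe, RingHom.mem_ker]
    change (rename θ).toRingHom _ = 0
    rw [← Polynomial.coeff_map, rootsDiff, Polynomial.map_sub, Polynomial.map_prod,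
      Polynomial.map_prod]
    have hA : ∏ a ∈ A, Polynomial.map (rename (R := K) θ).toRingHom
        (Polynomial.X - Polynomial.C (X a)) = ∏ a ∈ A, (Polynomial.X - Polynomial.C (X a)) := by
      refine Finset.prod_congr rfl fun a ha => ?_
      have : θ a = a := hθ.2 a (Finset.disjoint_left.mp hAB ha)
      simp [this]
    have hB : ∏ b ∈ B, Polynomial.map (rename (R := K) θ).toRingHom
        (Polynomial.X - Polynomial.C (X b)) = ∏ a ∈ A, (Polynomial.X - Polynomial.C (X a)) := by
      refine Finset.prod_nbij θ (fun b hb => hθ.1.mapsTo hb) hθ.1.injOn hθ.1.surjOn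
        fun b _ => ?_
      simp
    rw [hA, hB, sub_self, Polynomial.coeff_zero]
  exact h hP

theorem gluing_comp_update [DecidableEq τ] {A B : Finset τ} (hAB : Disjoint A B) {a b : τ}
    (ha : a ∈ A) (hb : b ∈ B) {θ : τ → τ} (hθ : θ ∈ Gluing (A.erase a) (B.erase b)) :
    θ ∘ Function.update id b a ∈ Gluing A B ∧ (θ ∘ Function.update id b a) b = a := by
  have haB : a ∉ B := Finset.disjoint_left.mp hAB ha
  have hθa : θ a = a := hθ.2 a fun h => haB (Finset.mem_of_mem_erase h)
  have h1 : (θ ∘ Function.update id b a) b = a := by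
    rw [Function.comp_apply, Function.update_self, hθa]
  have h2 : ∀ s, s ≠ b → (θ ∘ Function.update id b a) s = θ s := fun s hs => by
    rw [Function.comp_apply, Function.update_of_ne hs, id]
  refine ⟨⟨?_, fun s hs => ?_⟩, h1⟩
  · have hA : (A : Set τ) = insert a ↑(A.erase a) := by
      rw [← Finset.coe_insert, Finset.insert_erase ha]
    have hB : (B : Set τ) = insert b ↑(B.erase b) := by
      rw [← Finset.coe_insert, Finset.insert_erase hb]
    have h3 : Set.BijOn (θ ∘ Function.update id b a) ↑(B.erase b) ↑(A.erase a) :=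
      hθ.1.congr fun s hs => (h2 s (Finset.ne_of_mem_erase hs)).symm
    rw [hA, hB]
    have h4 := h3.insert (a := b) (by rw [h1]; simp)
    rwa [h1] at h4
  · have hsb : s ≠ b := by rintro rfl; exact hs hb
    rw [h2 s hsb]
    exact hθ.2 s fun h => hs (Finset.mem_of_mem_erase h)

/-- The symmetric ideal is the ideal of the union of the graphs of all bijections `B → A`; in
particular it is radical. -/
theorem mem_symmIdeal_of_rename [IsDomain K] {A B : Finset τ} (hAB : Disjoint A B)
    {P : MvPolynomial τ K} (h : ∀ θ ∈ Gluing A B, rename θ P = 0) : P ∈ symmIdeal K A B := by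
  classical
  by_cases hcard : A.card = B.card
  swap
  · rw [symmIdeal_eq_top hcard]; trivial
  induction hn : B.card generalizing A B P with
  | zero =>
    have hB : B = ∅ := Finset.card_eq_zero.mp hn
    have hA : A = ∅ := Finset.card_eq_zero.mp (hcard.trans hn)
    subst hB hA
    have := h id ⟨by simp, fun _ _ => rfl⟩
    rw [rename_id_apply] at this
    rw [this]; exact zero_mem _
  | succ n ih =>
    obtain ⟨b, hb⟩ : B.Nonempty := Finset.card_pos.mp (by omega)
    -- The factors `X b - X a` are split off `P` one by one modulo the ideal; once all are present,
    -- the product lies in the ideal by `prod_sub_mem_symmIdeal`.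
    have key : ∀ A' ⊆ A, ∃ Q, P - (∏ a ∈ A', (X b - X a)) * Q ∈ symmIdeal K A B := by
      intro A'
      induction A' using Finset.induction_on with
      | empty => exact fun _ => ⟨P, by simp⟩
      | insert a A' haA' ihA =>
        intro hsub
        have haA : a ∈ A := hsub (Finset.mem_insert_self a A')
        obtain ⟨Q, hQ⟩ := ihA ((Finset.subset_insert _ _).trans hsub)
        -- On a graph with `b ↦ a` the factors already split off become `X a - X x ≠ 0` with `x ≠
        -- a`, so `Q` itself vanishes there, and induction applies to its restriction to `X b = X
        -- a`.
        have hQ1 : rename (Function.update id b a) Q ∈ symmIdeal K (A.erase a) (B.erase b) := by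
          refine ih (hAB.mono (Finset.erase_subset _ _) (Finset.erase_subset _ _)) ?_ ?_ ?_
          · intro θ hθ
            obtain ⟨hθ', hθb⟩ := gluing_comp_update hAB haA hb hθ
            rw [rename_rename]
            have h0 := rename_eq_zero_of_mem_symmIdeal hAB hθ' hQ
            rw [map_sub, h _ hθ', zero_sub, neg_eq_zero, map_mul, map_prod] at h0
            refine (mul_eq_zero.mp h0).resolve_left (Finset.prod_ne_zero_iff.mpr ?_)
            intro x hx
            have hxB : x ∉ B := Finset.disjoint_left.mp hAB (hsub (Finset.mem_insert_of_mem hx))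
            rw [map_sub, rename_X, rename_X, hθb, hθ'.2 x hxB, sub_ne_zero]
            intro hax
            exact haA' (X_injective hax ▸ hx)
          · rw [Finset.card_erase_of_mem haA, Finset.card_erase_of_mem hb, hcard]
          · rw [Finset.card_erase_of_mem hb, hn]; rfl
        have hQ2 : Q ∈ symmIdeal K A B ⊔ Ideal.span {X b - X a} := by
          rw [← sub_add_cancel Q (rename (Function.update id b a) Q)]
          exact add_mem (le_sup_right (a := symmIdeal K A B) (sub_rename_update_mem a b Q))
            (symmIdeal_erase_le haA hb hQ1)
        obtain ⟨R, hR, S, hS, hRS⟩ := Submodule.mem_sup.mp hQ2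
        obtain ⟨U, hU⟩ := Ideal.mem_span_singleton'.mp hS
        refine ⟨U, ?_⟩
        rw [Finset.prod_insert haA']
        have h3 := add_mem hQ (Ideal.mul_mem_left _ (∏ a ∈ A', (X b - X a)) hR)
        convert h3 using 1
        rw [← hRS, ← hU]
        ring
    obtain ⟨Q, hQ⟩ := key A subset_rfl
    have := add_mem hQ (Ideal.mul_mem_right Q _ (prod_sub_mem_symmIdeal A B hb))
    rwa [sub_add_cancel] at this

end SymmetricIdeal

/-! ### Polarization and Taylor's formula in arbitrarily many variables -/

section Polarization

variable {σ : Type*}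

/-- The directional derivative along `ℓ`. -/
def dirDeriv (ℓ : σ → ℂ) : Derivation ℂ (MvPolynomial σ ℂ) (MvPolynomial σ ℂ) :=
  mkDerivation ℂ fun v => C (ℓ v)

theorem dirDeriv_X (ℓ : σ → ℂ) (v : σ) : dirDeriv ℓ (X v) = C (ℓ v) := mkDerivation_X _ _ _

/-- The directional derivative as a linear function of the direction. -/
def dirDerivLinear : (σ → ℂ) →ₗ[ℂ] Module.End ℂ (MvPolynomial σ ℂ) where
  toFun ℓ := (dirDeriv ℓ : MvPolynomial σ ℂ →ₗ[ℂ] MvPolynomial σ ℂ)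
  map_add' ℓ ℓ' := by
    have h : dirDeriv (ℓ + ℓ') = dirDeriv ℓ + dirDeriv ℓ' := by
      apply MvPolynomial.derivation_ext
      intro v
      rw [Derivation.add_apply, dirDeriv_X, dirDeriv_X, dirDeriv_X, Pi.add_apply, map_add]
    rw [h]; rfl
  map_smul' a ℓ := by
    have h : dirDeriv (a • ℓ) = a • dirDeriv ℓ := by
      apply MvPolynomial.derivation_ext
      intro v
      rw [Derivation.smul_apply, dirDeriv_X, dirDeriv_X, Pi.smul_apply, smul_eq_mul, map_mul,
        MvPolynomial.smul_eq_C_mul]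
    rw [h]; rfl

theorem dirDerivLinear_apply (ℓ : σ → ℂ) (f : MvPolynomial σ ℂ) :
    dirDerivLinear ℓ f = dirDeriv ℓ f := rfl

/-- The iterated directional derivative of `f` at `0`. -/
def polar (f : MvPolynomial σ ℂ) (N : ℕ) : MultilinearMap ℂ (fun _ : Fin N => σ → ℂ) ℂ :=
  LinearMap.compMultilinearMap
    (((aeval 0 : MvPolynomial σ ℂ →ₐ[ℂ] ℂ).toLinearMap).comp (LinearMap.applyₗ f))
    ((MultilinearMap.mkPiAlgebraFin ℂ N (Module.End ℂ (MvPolynomial σ ℂ))).compLinearMap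
      fun _ => dirDerivLinear)

theorem polar_apply (f : MvPolynomial σ ℂ) {N : ℕ} (ℓ : Fin N → σ → ℂ) :
    polar f N ℓ =
      aeval (0 : σ → ℂ) ((List.ofFn fun s => dirDerivLinear (ℓ s)).prod f) := by
  simp [polar]

theorem dirDeriv_aeval {a : σ → MvPolynomial σ ℂ} {ℓ ℓ' : σ → ℂ}
    (h : ∀ v, dirDeriv ℓ (a v) = C (ℓ' v)) (f : MvPolynomial σ ℂ) :
    dirDeriv ℓ (aeval a f) = aeval a (dirDeriv ℓ' f) := by
  induction f using MvPolynomial.induction_on with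
  | C c =>
    have h1 : (C c : MvPolynomial σ ℂ) = algebraMap ℂ _ c := rfl
    rw [h1, AlgHom.commutes, Derivation.map_algebraMap, Derivation.map_algebraMap, map_zero]
  | add p q hp hq => simp only [map_add, hp, hq]
  | mul_X p v hp =>
    rw [map_mul, Derivation.leibniz, Derivation.leibniz, hp, aeval_X, h, dirDeriv_X, map_add,
      smul_eq_mul, smul_eq_mul, smul_eq_mul, smul_eq_mul, map_mul, map_mul, aeval_X]
    congr 2
    exact (AlgHom.commutes _ _).symm

/-- The chain rule for a linear substitution. -/
theorem polar_aeval {a : σ → MvPolynomial σ ℂ} (ha : ∀ v, aeval (0 : σ → ℂ) (a v) = 0) {N : ℕ}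
    {ℓ ℓ' : Fin N → σ → ℂ} (h : ∀ s v, dirDeriv (ℓ s) (a v) = C (ℓ' s v))
    (f : MvPolynomial σ ℂ) : polar (aeval a f) N ℓ = polar f N ℓ' := by
  rw [polar_apply, polar_apply]
  have h1 : (List.ofFn fun s => dirDerivLinear (ℓ s)).prod (aeval a f) =
      aeval a ((List.ofFn fun s => dirDerivLinear (ℓ' s)).prod f) := by
    induction N with
    | zero => simp
    | succ N ih =>
      rw [List.ofFn_succ, List.ofFn_succ, List.prod_cons, List.prod_cons, Module.End.mul_apply,
        Module.End.mul_apply, ih fun s v => h s.succ v]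
      exact dirDeriv_aeval (h 0) _
  rw [h1, ← AlgHom.comp_apply, MvPolynomial.comp_aeval]
  congr 2
  funext v
  exact ha v

/-- Setting the variables outside `f.vars` to zero does not change `f`, and by the chain rule it
replaces the direction `v s` by `0`. -/
theorem polar_single_eq_zero [DecidableEq σ] {f : MvPolynomial σ ℂ} {N : ℕ} {v : Fin N → σ}
    {s : Fin N} (hs : v s ∉ f.vars) : polar f N (fun s => Pi.single (v s) 1) = 0 := by
  have hf : f = aeval (fun v => if v ∈ f.vars then X v else 0) f := by
    conv_lhs => rw [← aeval_X_left_apply f]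
    refine MvPolynomial.eval₂Hom_congr' rfl (fun i hi _ => ?_) rfl
    rw [if_pos hi]
  conv_lhs => rw [hf]
  rw [polar_aeval (ℓ' := fun s x => if x ∈ f.vars then (Pi.single (v s) 1 : σ → ℂ) x else 0)]
  · apply (polar f N).map_coord_zero s
    funext x
    split_ifs with hx
    · exact Pi.single_eq_of_ne (by rintro rfl; exact hs hx) _
    · rfl
  · intro x; split_ifs <;> simp
  · intro s x
    split_ifs with hx
    · exact dirDeriv_X _ _
    · simp

/-- Taylor's formula in one variable for the restriction `T ↦ f (T ℓ)` to a line, at `T = 1`. -/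
theorem eval_eq_sum_polar (f : MvPolynomial σ ℂ) (ℓ : σ → ℂ) :
    eval ℓ f = ∑ N ∈ Finset.range (f.totalDegree + 1),
      (N.factorial : ℂ)⁻¹ * polar f N fun _ => ℓ := by
  set φ : MvPolynomial σ ℂ →ₐ[ℂ] Polynomial ℂ :=
    aeval fun v => Polynomial.C (ℓ v) * Polynomial.X with hφ
  have h1 : ∀ g, φ (dirDeriv ℓ g) = Polynomial.derivative (φ g) := by
    intro g
    induction g using MvPolynomial.induction_on with
    | C c =>
      have h1 : (C c : MvPolynomial σ ℂ) = algebraMap ℂ _ c := rfl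
      rw [h1, AlgHom.commutes, Derivation.map_algebraMap, map_zero]
      exact Polynomial.derivative_C.symm
    | add p q hp hq => simp only [map_add, hp, hq]
    | mul_X p v hp =>
      have h2 : φ (C (ℓ v)) = Polynomial.C (ℓ v) := AlgHom.commutes φ _
      rw [Derivation.leibniz, dirDeriv_X, map_add, smul_eq_mul, smul_eq_mul, map_mul, map_mul,
        hp, map_mul, Polynomial.derivative_mul, h2, hφ, aeval_X, Polynomial.derivative_C_mul,
        Polynomial.derivative_X]
      ring
  have h2 : ∀ (N : ℕ) g, φ ((List.ofFn fun _ : Fin N => dirDerivLinear ℓ).prod g) =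
      Polynomial.derivative^[N] (φ g) := by
    intro N
    induction N with
    | zero => simp
    | succ N ih =>
      intro g
      rw [List.ofFn_succ, List.prod_cons, Module.End.mul_apply, dirDerivLinear_apply, h1, ih,
        Function.iterate_succ_apply']
  have h3 : ∀ g, aeval (0 : σ → ℂ) g = (φ g).coeff 0 := by
    intro g
    have : (Polynomial.aeval (0 : ℂ)).comp φ = aeval (0 : σ → ℂ) := by
      apply MvPolynomial.algHom_ext
      intro v
      rw [AlgHom.comp_apply, hφ, aeval_X, aeval_X]
      simp
    rw [← this, AlgHom.comp_apply, Polynomial.coeff_zero_eq_aeval_zero]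
  have h4 : eval ℓ f = (φ f).eval 1 := by
    have : (Polynomial.aeval (1 : ℂ)).comp φ = aeval ℓ := by
      apply MvPolynomial.algHom_ext
      intro v
      rw [AlgHom.comp_apply, hφ, aeval_X, aeval_X]
      simp
    rw [← MvPolynomial.aeval_eq_eval]
    exact (DFunLike.congr_fun this f).symm
  have h5 : (φ f).natDegree < f.totalDegree + 1 := by
    have := MvPolynomial.aeval_natDegree_le f le_rfl
      (fun v => Polynomial.C (ℓ v) * Polynomial.X) (n := 1)
      (fun v => (Polynomial.natDegree_C_mul_le _ _).trans Polynomial.natDegree_X_le)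
    rw [mul_one] at this
    exact Nat.lt_succ_of_le this
  rw [h4, Polynomial.eval_eq_sum_range' h5]
  refine Finset.sum_congr rfl fun N _ => ?_
  rw [polar_apply, h3, h2, Polynomial.coeff_iterate_derivative, zero_add,
    Nat.descFactorial_self, nsmul_eq_mul, one_pow, mul_one, inv_mul_cancel_left₀]
  exact Nat.cast_ne_zero.mpr N.factorial_ne_zero

/-- Taylor's formula in terms of the iterated partial derivatives at `0`. -/
theorem eq_sum_polar [DecidableEq σ] (f : MvPolynomial σ ℂ) :
    f = ∑ N ∈ Finset.range (f.totalDegree + 1), ∑ v ∈ Fintype.piFinset fun _ : Fin N => f.vars,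
      ((N.factorial : ℂ)⁻¹ * polar f N fun s => Pi.single (v s) 1) • ∏ s, X (v s) := by
  apply MvPolynomial.funext
  intro ℓ
  set ℓ' : σ → ℂ := ∑ v ∈ f.vars, ℓ v • Pi.single v (1 : ℂ) with hℓ'
  have h1 : eval ℓ f = eval ℓ' f := by
    refine MvPolynomial.eval₂Hom_congr' rfl (fun i hi _ => ?_) rfl
    rw [hℓ', Finset.sum_apply, Finset.sum_eq_single i]
    · simp
    · intro b _ hb
      simp [Pi.single_eq_of_ne hb.symm]
    · exact fun h => absurd hi h
  rw [h1, eval_eq_sum_polar, map_sum]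
  refine Finset.sum_congr rfl fun N _ => ?_
  have h2 := MultilinearMap.map_sum_finset (polar f N)
    (fun (_ : Fin N) (v : σ) => (ℓ v • Pi.single v (1 : ℂ) : σ → ℂ)) fun _ => f.vars
  rw [hℓ', h2, map_sum, Finset.mul_sum]
  refine Finset.sum_congr rfl fun v _ => ?_
  rw [MultilinearMap.map_smul_univ, smul_eval, map_prod]
  simp only [eval_X, smul_eq_mul]
  ring

end Polarization

/-! ### What invariance means for the multilinear forms when the weights are `0, 1, -1` -/

section Invariance

variable {ι : Type*} (w : ι → ℤ)

theorem jcoeff_mul {A : Type*} [CommRing A] (k : ℕ) (f g : JetRing ⊤ A) :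
    jcoeff ⟨k, le_top⟩ (f * g) = ∑ p ∈ Finset.HasAntidiagonal.antidiagonal k,
      jcoeff ⟨p.1, le_top⟩ f * jcoeff ⟨p.2, le_top⟩ g := by
  obtain ⟨f, rfl⟩ := Ideal.Quotient.mk_surjective f
  obtain ⟨g, rfl⟩ := Ideal.Quotient.mk_surjective g
  rw [← map_mul, jcoeff_mk, PowerSeries.coeff_mul]
  rfl

/-- The action of `G_∞` on complex points of `V_∞`. -/
def smulArc (g : GJet ⊤) (ℓ : ι × JetIdx ⊤ → ℂ) : ι × JetIdx ⊤ → ℂ := fun p =>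
  jcoeff p.2 (((g ^ w p.1 : GJet ⊤) : JetRing ⊤ ℂ) * jmk fun k => ℓ (p.1, k))

/-- `G_∞` acts linearly, so polarization commutes with the action by the chain rule. -/
theorem polar_smulArc {f : VJet ι ⊤} (hf : f ∈ jetInv w ⊤) (g : GJet ⊤) {N : ℕ}
    (ℓ : Fin N → ι × JetIdx ⊤ → ℂ) :
    polar f N (fun s => smulArc w g (ℓ s)) = polar f N ℓ := by
  conv_rhs => rw [← (mem_jetInv w).mp hf g]
  have h : ∀ (i : ι) (k : ℕ), jcoeff ⟨k, le_top⟩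
      (jmap ⊤ (Algebra.ofId ℂ (VJet ι ⊤)) ((g ^ w i : GJet ⊤) : JetRing ⊤ ℂ) * coordJet ⊤ i) =
      ∑ p ∈ Finset.HasAntidiagonal.antidiagonal k,
        C (jcoeff ⟨p.1, le_top⟩ ((g ^ w i : GJet ⊤) : JetRing ⊤ ℂ)) * X (i, ⟨p.2, le_top⟩) := by
    intro i k
    rw [jcoeff_mul]
    refine Finset.sum_congr rfl fun p _ => ?_
    rw [jcoeff_jmap, coordJet, jcoeff_jmk]
    rfl
  rw [jetAct]
  refine (polar_aeval (fun v => ?_) (fun s v => ?_) f).symm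
  · obtain ⟨i, k, _⟩ := v
    rw [h, map_sum]
    refine Finset.sum_eq_zero fun p _ => ?_
    rw [map_mul, aeval_X, Pi.zero_apply, mul_zero]
  · obtain ⟨i, k, _⟩ := v
    rw [h, map_sum, smulArc, jcoeff_mul, map_sum]
    refine Finset.sum_congr rfl fun p _ => ?_
    rw [Derivation.leibniz, dirDeriv_X, jcoeff_jmk, smul_eq_mul, smul_eq_mul, ← map_mul]
    have : dirDeriv (ℓ s) (C (jcoeff ⟨p.1, le_top⟩ ((g ^ w i : GJet ⊤) : JetRing ⊤ ℂ))) = 0 :=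
      Derivation.map_algebraMap _ _
    rw [this, mul_zero, add_zero]

variable [DecidableEq ι]

/-- The arc in `V` with `i`-th coordinate `P`, all others being zero. -/
def polyArc (i : ι) : Polynomial ℂ →ₗ[ℂ] (ι × JetIdx ⊤ → ℂ) where
  toFun P p := if p.1 = i then P.coeff p.2.1 else 0
  map_add' P Q := by ext p; simp only [Pi.add_apply]; split_ifs <;> simp
  map_smul' a P := by ext p; simp only [Pi.smul_apply]; split_ifs <;> simp

theorem polyArc_apply (i : ι) (P : Polynomial ℂ) (p : ι × JetIdx ⊤) :
    polyArc i P p = if p.1 = i then P.coeff p.2.1 else 0 := rfl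

theorem polyArc_monomial (i : ι) (k : ℕ) :
    polyArc i (Polynomial.monomial k 1) = Pi.single (i, ⟨k, le_top⟩) 1 := by
  ext ⟨j, l, hl⟩
  rw [polyArc_apply, Pi.single_apply, Polynomial.coeff_monomial]
  by_cases hj : j = i
  · subst hj
    simp [eq_comm]
  · simp [hj]

theorem smulArc_polyArc {g : GJet ⊤} {i : ι} {P Q : Polynomial ℂ}
    (h : ((g ^ w i : GJet ⊤) : JetRing ⊤ ℂ) * Ideal.Quotient.mk _ (P : PowerSeries ℂ) =
      Ideal.Quotient.mk _ (Q : PowerSeries ℂ)) :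
    smulArc w g (polyArc i P) = polyArc i Q := by
  have hmk : ∀ (P : Polynomial ℂ) (k : ℕ), jcoeff ⟨k, le_top⟩
      (Ideal.Quotient.mk (jetIdeal ⊤ ℂ) (P : PowerSeries ℂ)) = P.coeff k := by
    intro P k
    rw [jcoeff_mk, Polynomial.coeff_coe]
  ext ⟨j, k, hk⟩
  rw [smulArc, polyArc_apply]
  by_cases hj : j = i
  · subst hj
    rw [if_pos rfl, ← hmk, ← h]
    congr 2
    apply JetRing.ext
    rintro ⟨l, hl⟩
    rw [hmk, jcoeff_jmk, polyArc_apply, if_pos rfl]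
  · rw [if_neg hj]
    have : (jmk fun k => polyArc i P (j, k) : JetRing ⊤ ℂ) = 0 := by
      apply JetRing.ext
      intro l
      rw [jcoeff_jmk, polyArc_apply, if_neg hj, map_zero]
    rw [this, mul_zero, map_zero]

theorem exists_gJet_eq_C_sub_X {θ : ℂ} (hθ : θ ≠ 0) : ∃ g : GJet ⊤, (g : JetRing ⊤ ℂ) =
    Ideal.Quotient.mk _ ((Polynomial.C θ - Polynomial.X : Polynomial ℂ) : PowerSeries ℂ) := by
  have h : IsUnit (Ideal.Quotient.mk (jetIdeal ⊤ ℂ)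
      ((Polynomial.C θ - Polynomial.X : Polynomial ℂ) : PowerSeries ℂ)) := by
    apply isUnit_of_jcoeff_zero
    rw [jcoeff_mk, Polynomial.coeff_coe]
    simpa using hθ
  exact ⟨h.unit, h.unit_spec⟩

variable {w} {f : VJet ι ⊤} {N : ℕ} (c : Fin N → ι)

/-- Acting by `g = θ - t` creates a factor `θ - t` in the arcs of weight `1` and cancels it in those
of weight `-1`. Placing the factors on the two sides in this way avoids `g⁻¹`, which is not a
polynomial. -/
theorem polar_polyArc_ite (hw : ∀ i, w i = 0 ∨ w i = 1 ∨ w i = -1) (hf : f ∈ jetInv w ⊤) {θ : ℂ}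
    (hθ : θ ≠ 0) (P : Fin N → Polynomial ℂ) :
    polar f N (fun s => polyArc (c s)
      (if w (c s) = -1 then (Polynomial.C θ - Polynomial.X) * P s else P s)) =
    polar f N (fun s => polyArc (c s)
      (if w (c s) = 1 then (Polynomial.C θ - Polynomial.X) * P s else P s)) := by
  obtain ⟨g, hg⟩ := exists_gJet_eq_C_sub_X hθ
  rw [← polar_smulArc w hf g]
  congr 1
  funext s
  apply smulArc_polyArc
  rcases hw (c s) with h | h | h
  · simp [h]
  · rw [if_neg (by rw [h]; norm_num), if_pos h, h, zpow_one, hg, ← map_mul, Polynomial.coe_mul]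
  · rw [if_pos h, if_neg (by rw [h]; norm_num), h, zpow_neg_one, Polynomial.coe_mul, map_mul, ← hg,
      Units.inv_mul_cancel_left]

variable (f) in
/-- The multilinear form `polar f N` restricted to the components `c`, as a linear form on
polynomials in `N` variables. -/
def polarForm : MvPolynomial (Fin N) ℂ →ₗ[ℂ] ℂ :=
  (basisMonomials (Fin N) ℂ).constr ℂ fun k =>
    polar f N fun s => Pi.single (c s, ⟨k s, le_top⟩) 1

variable (f) in
theorem polarForm_monomial (k : Fin N →₀ ℕ) : polarForm f c (monomial k 1) =
    polar f N fun s => Pi.single (c s, ⟨k s, le_top⟩) 1 := by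
  have h := (basisMonomials (Fin N) ℂ).constr_basis ℂ (fun k =>
    polar f N fun s => Pi.single (c s, ⟨k s, le_top⟩) 1) k
  rwa [coe_basisMonomials] at h

-- Both sides are multilinear in `P`, so monomials suffice.
variable (f) in
theorem polarForm_prod (P : Fin N → Polynomial ℂ) :
    polarForm f c (∏ s, Polynomial.aeval (X s) (P s)) = polar f N fun s => polyArc (c s) (P s) := by
  have h : (polarForm f c).compMultilinearMap
      ((MultilinearMap.mkPiAlgebra ℂ (Fin N) (MvPolynomial (Fin N) ℂ)).compLinearMap
        fun s => (Polynomial.aeval (R := ℂ) (X s : MvPolynomial (Fin N) ℂ)).toLinearMap) =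
      (polar f N).compLinearMap fun s => polyArc (c s) := by
    apply Module.Basis.ext_multilinear fun _ => Polynomial.basisMonomials ℂ
    intro k
    simp only [LinearMap.compMultilinearMap_apply, MultilinearMap.compLinearMap_apply,
      MultilinearMap.mkPiAlgebra_apply, Polynomial.coe_basisMonomials, AlgHom.toLinearMap_apply,
      polyArc_monomial, Polynomial.aeval_monomial, map_one, one_mul]
    have : (∏ s, X s ^ k s : MvPolynomial (Fin N) ℂ) =
        monomial (Finsupp.equivFunOnFinite.symm k) 1 := by
      rw [MvPolynomial.monomial_eq, map_one, one_mul, Finsupp.prod_fintype _ _ (by simp)]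
      rfl
    rw [this, polarForm_monomial]
    rfl
  exact DFunLike.congr_fun h P

theorem polarForm_prod_mul (hw : ∀ i, w i = 0 ∨ w i = 1 ∨ w i = -1) (hf : f ∈ jetInv w ⊤) {θ : ℂ}
    (hθ : θ ≠ 0) (P : MvPolynomial (Fin N) ℂ) :
    polarForm f c ((∏ s with w (c s) = -1, (C θ - X s)) * P) =
      polarForm f c ((∏ s with w (c s) = 1, (C θ - X s)) * P) := by
  induction P using MvPolynomial.induction_on' with
  | add p q hp hq => rw [mul_add, mul_add, map_add, map_add, hp, hq]
  | monomial k a =>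
    have key : ∀ ε : ℤ, (∏ s with w (c s) = ε, (C θ - X s)) * (monomial k a) =
        a • ∏ s, Polynomial.aeval (X s) (if w (c s) = ε then
          (Polynomial.C θ - Polynomial.X) * Polynomial.X ^ k s else Polynomial.X ^ k s) := by
      intro ε
      have h1 : ∀ s, Polynomial.aeval (X s) (if w (c s) = ε then
          (Polynomial.C θ - Polynomial.X) * Polynomial.X ^ k s else Polynomial.X ^ k s) =
          (if w (c s) = ε then (C θ - X s : MvPolynomial (Fin N) ℂ) else 1) * X s ^ k s := by
        intro s
        split_ifs
        · simp [MvPolynomial.algebraMap_eq]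
        · simp
      simp only [h1]
      rw [Finset.prod_mul_distrib, Finset.prod_filter, MvPolynomial.monomial_eq,
        Finsupp.prod_fintype _ _ (by simp), MvPolynomial.smul_eq_C_mul]
      ring
    rw [key, key, map_smul, map_smul, polarForm_prod, polarForm_prod,
      polar_polyArc_ite c hw hf hθ]

/-- The linear forms of an invariant vanish on the symmetric ideal. -/
theorem polarForm_eq_zero (hw : ∀ i, w i = 0 ∨ w i = 1 ∨ w i = -1) (hf : f ∈ jetInv w ⊤)
    {P : MvPolynomial (Fin N) ℂ}
    (hP : P ∈ symmIdeal ℂ (Finset.univ.filter fun s => w (c s) = 1)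
      (Finset.univ.filter fun s => w (c s) = -1)) : polarForm f c P = 0 := by
  set R := rootsDiff ℂ (Finset.univ.filter fun s => w (c s) = 1)
      (Finset.univ.filter fun s => w (c s) = -1) with hR
  have h1 : ∀ n Q, polarForm f c (R.coeff n * Q) = 0 := by
    intro n Q
    set p : Polynomial ℂ := ∑ n ∈ Finset.range (R.natDegree + 1),
      Polynomial.monomial n (polarForm f c (R.coeff n * Q)) with hp
    -- The generators are the coefficients of a polynomial in `θ`; the identity holds only for `θ ≠
    -- 0`, and the extra factor covers `θ = 0`.
    have hp0 : Polynomial.X * p = 0 := by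
      apply Polynomial.funext
      intro θ
      rw [Polynomial.eval_mul, Polynomial.eval_X, Polynomial.eval_zero]
      by_cases hθ : θ = 0
      · rw [hθ, zero_mul]
      have h2 : p.eval θ = polarForm f c (R.eval (C θ) * Q) := by
        rw [hp, Polynomial.eval_finsetSum, Polynomial.eval_eq_sum_range, Finset.sum_mul, map_sum]
        refine Finset.sum_congr rfl fun n _ => ?_
        rw [Polynomial.eval_monomial, ← map_pow, mul_assoc, mul_comm (C _), ← mul_assoc, mul_comm _ (C _),
          ← MvPolynomial.smul_eq_C_mul, map_smul, smul_eq_mul, mul_comm]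
      rw [h2, hR, rootsDiff, Polynomial.eval_sub, Polynomial.eval_prod, Polynomial.eval_prod]
      simp only [Polynomial.eval_sub, Polynomial.eval_X, Polynomial.eval_C]
      rw [sub_mul, map_sub, polarForm_prod_mul c hw hf hθ, sub_self, mul_zero]
    have hp1 : p = 0 := (mul_eq_zero.mp hp0).resolve_left Polynomial.X_ne_zero
    by_cases hn : n < R.natDegree + 1
    · have h3 : p.coeff n = polarForm f c (R.coeff n * Q) := by
        rw [hp, Polynomial.finsetSum_coeff, Finset.sum_eq_single n]
        · rw [Polynomial.coeff_monomial_same]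
        · intro b _ hb; exact Polynomial.coeff_monomial_of_ne _ hb.symm
        · intro h; exact absurd (Finset.mem_range.mpr hn) h
      rw [← h3, hp1, Polynomial.coeff_zero]
    · rw [Polynomial.coeff_eq_zero_of_natDegree_lt (by omega), zero_mul, map_zero]
  suffices h2 : ∀ Q, polarForm f c (P * Q) = 0 by
    have := h2 1
    rwa [mul_one] at this
  rw [symmIdeal] at hP
  induction hP using Submodule.span_induction with
  | mem x hx =>
    obtain ⟨n, rfl⟩ := hx
    exact h1 n
  | zero => intro Q; rw [zero_mul, map_zero]
  | add x y _ _ hx hy => intro Q; rw [add_mul, map_add, hx, hy, add_zero]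
  | smul a x _ hx => intro Q; rw [smul_eq_mul, mul_comm a, mul_assoc, hx]

end Invariance

/-! ### Case (2): surjectivity by duality, and the trichotomy of weights -/

section CaseTwo

variable {ι : Type*} {w : ι → ℤ} {N : ℕ} (c : Fin N → ι)

/-- The monomial `∏ x_{c s, k s}`. -/
def arcMonomial (k : Fin N →₀ ℕ) : VJet ι ⊤ := ∏ s, X (c s, ⟨k s, le_top⟩)

theorem jcoeff_univJet_prod (F : Finset (Fin N)) (n : ℕ) :
    jcoeff ⟨n, le_top⟩ (univJet ι ⊤ (∏ s ∈ F, X (c s))) =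
      ∑ l ∈ F.finsuppAntidiag n, ∏ s ∈ F, X (c s, ⟨l s, le_top⟩) := by
  have h1 : univJet ι ⊤ (∏ s ∈ F, X (c s)) = Ideal.Quotient.mk _
      (∏ s ∈ F, PowerSeries.mk fun k => X (c s, ⟨k, le_top⟩)) := by
    rw [map_prod, map_prod]
    refine Finset.prod_congr rfl fun s _ => ?_
    rw [univJet, aeval_X]
    apply JetRing.ext
    intro k
    rw [coordJet, jcoeff_jmk, jcoeff_mk, PowerSeries.coeff_mk]
  rw [h1, jcoeff_mk, PowerSeries.coeff_prod]
  simp only [PowerSeries.coeff_mk]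

theorem mapDomain_apply_fintype {κ : Type*} [Fintype κ] [DecidableEq κ] (θ : κ → κ) (k : κ →₀ ℕ)
    (s' : κ) : Finsupp.mapDomain θ k s' = ∑ s with θ s = s', k s := by
  rw [Finsupp.mapDomain, Finsupp.sum_apply, Finsupp.sum_fintype _ _ (by simp), Finset.sum_filter]
  refine Finset.sum_congr rfl fun s _ => ?_
  rw [Finsupp.single_apply]

/-- A product of coefficients of jets of monomials, expanded. -/
theorem sum_arcMonomial (θ : Fin N → Fin N) (m : Fin N →₀ ℕ) :
    ∑ k ∈ (Finset.univ.finsuppAntidiag (∑ s, m s)).filter (fun k => Finsupp.mapDomain θ k = m),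
      arcMonomial c k =
    ∏ s', jcoeff ⟨m s', le_top⟩ (univJet ι ⊤ (∏ s with θ s = s', X (c s))) := by
  simp only [jcoeff_univJet_prod]
  rw [Finset.prod_univ_sum]
  symm
  -- An exponent `k` corresponds to the family of its restrictions to the fibres of `θ`; `mapDomain
  -- θ k = m` prescribes the sum over each fibre.
  refine Finset.sum_nbij' (fun L => Finsupp.equivFunOnFinite.symm fun s => L (θ s) s)
    (fun k s' => k.filter fun s => θ s = s') ?_ ?_ ?_ ?_ ?_
  · intro L hL
    have hL' : ∀ s', ∑ s with θ s = s', L s' s = m s' := fun s' =>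
      (Finset.mem_finsuppAntidiag.mp (Fintype.mem_piFinset.mp hL s')).1
    have h2 : Finsupp.mapDomain θ (Finsupp.equivFunOnFinite.symm fun s => L (θ s) s) = m := by
      ext s'
      rw [mapDomain_apply_fintype, ← hL']
      refine Finset.sum_congr rfl fun s hs => ?_
      rw [Finset.mem_filter] at hs
      rw [← hs.2]; rfl
    rw [Finset.mem_filter, Finset.mem_finsuppAntidiag]
    refine ⟨⟨?_, Finset.subset_univ _⟩, h2⟩
    rw [← Finset.sum_fiberwise _ θ]
    refine Finset.sum_congr rfl fun s' _ => ?_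
    rw [← hL']
    refine Finset.sum_congr rfl fun s hs => ?_
    rw [Finset.mem_filter] at hs
    rw [← hs.2]; rfl
  · intro k hk
    rw [Finset.mem_filter] at hk
    rw [Fintype.mem_piFinset]
    intro s'
    rw [Finset.mem_finsuppAntidiag, ← hk.2, mapDomain_apply_fintype]
    constructor
    · refine Finset.sum_congr rfl fun s hs => ?_
      exact Finsupp.filter_apply_pos _ _ (Finset.mem_filter.mp hs).2
    · intro s hs
      rw [Finsupp.support_filter, Finset.mem_filter] at hs
      exact Finset.mem_filter.mpr ⟨Finset.mem_univ _, hs.2⟩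
  · intro L hL
    funext s'
    ext s
    have hL' := (Finset.mem_finsuppAntidiag.mp (Fintype.mem_piFinset.mp hL s')).2
    rw [Finsupp.filter_apply]
    split_ifs with h
    · rw [← h]; rfl
    · by_contra hne
      have := hL' (Finsupp.mem_support_iff.mpr (Ne.symm hne))
      exact h (Finset.mem_filter.mp this).2
  · intro k _
    ext s
    change (k.filter fun x => θ x = θ s) s = k s
    exact Finsupp.filter_apply_pos _ _ rfl
  · intro L _
    refine Eq.trans ?_ (Finset.prod_fiberwise Finset.univ θ _)
    refine Finset.prod_congr rfl fun s' _ => Finset.prod_congr rfl fun s hs => ?_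
    rw [Finset.mem_filter] at hs
    rw [← hs.2]; rfl

/-- A fibre is a single index of weight `0`, a pair of weights `1` and `-1`, or empty. So the
product of the coordinates over a fibre is an invariant. -/
theorem sum_weight_gluing (hw : ∀ i, w i = 0 ∨ w i = 1 ∨ w i = -1) {θ : Fin N → Fin N}
    (hθ : θ ∈ Gluing (Finset.univ.filter fun s => w (c s) = 1)
      (Finset.univ.filter fun s => w (c s) = -1)) (s' : Fin N) :
    ∑ s with θ s = s', w (c s) = 0 := by
  have h1 : ∀ s, w (c s) ≠ -1 → θ s = s := fun s hs => hθ.2 s (by simpa using hs)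
  have h2 : ∀ s, w (c s) = -1 → w (c (θ s)) = 1 := fun s hs => by
    simpa using hθ.1.mapsTo (show s ∈ _ by simpa using hs)
  rcases hw (c s') with h | h | h
  · have : (Finset.univ.filter fun s => θ s = s') = {s'} := by
      ext s
      rw [Finset.mem_filter, Finset.mem_singleton]
      constructor
      · rintro ⟨_, hs⟩
        by_cases hb : w (c s) = -1
        · have := h2 s hb
          rw [hs, h] at this; omega
        · rw [← hs, h1 s hb]
      · rintro rfl
        exact ⟨Finset.mem_univ _, h1 _ (by omega)⟩
    rw [this, Finset.sum_singleton, h]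
  · obtain ⟨b, hb, hbs⟩ := hθ.1.surjOn (show s' ∈ _ by simpa using h)
    have hb' : w (c b) = -1 := by simpa using hb
    have hbs' : b ≠ s' := by rintro rfl; omega
    have : (Finset.univ.filter fun s => θ s = s') = {b, s'} := by
      ext s
      rw [Finset.mem_filter, Finset.mem_insert, Finset.mem_singleton]
      constructor
      · rintro ⟨_, hs⟩
        by_cases hsb : w (c s) = -1
        · left
          exact hθ.1.injOn (by simpa using hsb) hb (hs.trans hbs.symm)
        · right; rw [← hs, h1 s hsb]
      · rintro (rfl | rfl)
        · exact ⟨Finset.mem_univ _, hbs⟩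
        · exact ⟨Finset.mem_univ _, h1 _ (by omega)⟩
    rw [this, Finset.sum_pair hbs', hb', h]; norm_num
  · refine (Finset.sum_eq_zero fun s hs => ?_)
    exfalso
    have hs' := (Finset.mem_filter.mp hs).2
    by_cases hsb : w (c s) = -1
    · have := h2 s hsb
      rw [hs', h] at this; omega
    · rw [h1 s hsb] at hs'
      exact hsb (hs' ▸ h)

/-- By duality, the multihomogeneous components of an invariant are pulled back from `Z_∞`. -/
theorem sum_polarForm_mem_range [DecidableEq ι] (hw : ∀ i, w i = 0 ∨ w i = 1 ∨ w i = -1) {f : VJet ι ⊤}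
    (hf : f ∈ jetInv w ⊤) (d : ℕ) :
    ∑ k ∈ Finset.univ.finsuppAntidiag d, polarForm f c (monomial k 1) • arcMonomial c k ∈
      (pStarAux w ⊤).range := by
  by_contra hcon
  -- A linear form `ψ` that vanishes on the image of `p_∞^*` but not on the given sum. Its values on
  -- the monomials are the coefficients of `P`, so that `ψ` of the sum equals `polarForm f c P`.
  obtain ⟨ψ, hψ, hker⟩ := Submodule.exists_le_ker_of_notMem
    (p := Subalgebra.toSubmodule (pStarAux w ⊤).range) hcon
  apply hψ
  set P : MvPolynomial (Fin N) ℂ :=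
    ∑ k ∈ Finset.univ.finsuppAntidiag d, ψ (arcMonomial c k) • monomial k 1 with hP
  have h1 : ψ (∑ k ∈ Finset.univ.finsuppAntidiag d,
      polarForm f c (monomial k 1) • arcMonomial c k) = polarForm f c P := by
    rw [hP, map_sum, map_sum]
    refine Finset.sum_congr rfl fun k _ => ?_
    rw [map_smul, map_smul, smul_eq_mul, smul_eq_mul, mul_comm]
  rw [h1]
  apply polarForm_eq_zero c hw hf
  have hdisj : Disjoint (Finset.univ.filter fun s => w (c s) = 1)
      (Finset.univ.filter fun s => w (c s) = -1) := by
    rw [Finset.disjoint_filter]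
    intro s _ h
    rw [h]; norm_num
  apply mem_symmIdeal_of_rename hdisj
  intro θ hθ
  ext m
  -- By `sum_arcMonomial` the argument of `ψ` is a product of jet coefficients of invariants when
  -- `m` has degree `d`, so `ψ` kills it.
  have h2 : coeff m (rename θ P) = ψ (∑ k ∈ (Finset.univ.finsuppAntidiag d).filter
      (fun k => Finsupp.mapDomain θ k = m), arcMonomial c k) := by
    rw [hP, map_sum, coeff_sum, map_sum, Finset.sum_filter]
    refine Finset.sum_congr rfl fun k _ => ?_
    rw [map_smul, rename_monomial, coeff_smul, coeff_monomial]
    split_ifs <;> simp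
  rw [h2, coeff_zero]
  by_cases hd : ∑ s, m s = d
  · rw [← hd, sum_arcMonomial]
    refine hker (Subalgebra.prod_mem _ fun s' _ => ?_)
    exact jcoeff_univJet_mem_range w (prod_X_mem_invRing w _ _ (sum_weight_gluing c hw hθ s')) _
  · rw [Finset.filter_false_of_mem, Finset.sum_empty, map_zero]
    rintro k hk rfl
    apply hd
    simp only [mapDomain_apply_fintype]
    rw [Finset.sum_fiberwise]
    exact (Finset.mem_finsuppAntidiag.mp hk).1

theorem mem_range_of_mem_jetInv [Fintype ι] (hw : ∀ i, w i = 0 ∨ w i = 1 ∨ w i = -1)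
    {f : VJet ι ⊤} (hf : f ∈ jetInv w ⊤) : f ∈ (pStarAux w ⊤).range := by
  classical
  rw [eq_sum_polar f]
  refine Subalgebra.sum_mem _ fun N _ => ?_
  set t : (Fin N → ι × JetIdx ⊤) → VJet ι ⊤ := fun v =>
    ((N.factorial : ℂ)⁻¹ * polar f N fun s => Pi.single (v s) 1) • ∏ s, X (v s) with ht
  set V := Fintype.piFinset fun _ : Fin N => f.vars with hV
  set M := V.sup fun v => ∑ s, (v s).2.1 with hM
  let e : (Fin N → ι) × (Fin N →₀ ℕ) → (Fin N → ι × JetIdx ⊤) :=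
    fun p s => (p.1 s, ⟨p.2 s, le_top⟩)
  have he : Function.Injective e := by
    rintro ⟨c, k⟩ ⟨c', k'⟩ h
    have h1 : ∀ s, c s = c' s ∧ k s = k' s := fun s => by
      have := congrFun h s
      simpa [e] using this
    exact Prod.ext (funext fun s => (h1 s).1) (Finsupp.ext fun s => (h1 s).2)
  set W : Finset ((Fin N → ι) × (Fin N →₀ ℕ)) :=
    Finset.univ ×ˢ (Finset.range (M + 1)).biUnion fun d => Finset.univ.finsuppAntidiag d with hW
  -- The Taylor sum over the variables of `f` is enlarged, by terms that vanish, to full blocks with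
  -- given components `c` and given total order `d ≤ M`.
  have h1 : ∑ v ∈ V, t v = ∑ p ∈ W, t (e p) := by
    rw [← Finset.sum_image (s := W) (g := e) (f := t) he.injOn]
    apply Finset.sum_subset
    · intro v hv
      rw [Finset.mem_image]
      refine ⟨(fun s => (v s).1, Finsupp.equivFunOnFinite.symm fun s => (v s).2.1), ?_, rfl⟩
      rw [hW, Finset.mem_product, Finset.mem_biUnion]
      refine ⟨Finset.mem_univ _, ∑ s, (v s).2.1, ?_, ?_⟩
      · rw [Finset.mem_range]
        exact Nat.lt_succ_of_le (Finset.le_sup (f := fun v => ∑ s, (v s).2.1) hv)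
      · rw [Finset.mem_finsuppAntidiag]
        exact ⟨rfl, Finset.subset_univ _⟩
    · intro v _ hv
      rw [hV, Fintype.mem_piFinset] at hv
      push Not at hv
      obtain ⟨s, hs⟩ := hv
      rw [ht]
      simp only
      rw [polar_single_eq_zero hs, mul_zero, zero_smul]
  rw [h1, hW, Finset.sum_product]
  refine Subalgebra.sum_mem _ fun c _ => ?_
  rw [Finset.sum_biUnion]
  · refine Subalgebra.sum_mem _ fun d _ => ?_
    have h2 : ∑ k ∈ Finset.univ.finsuppAntidiag d, t (e (c, k)) = (N.factorial : ℂ)⁻¹ •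
        ∑ k ∈ Finset.univ.finsuppAntidiag d,
          polarForm f c (monomial k 1) • arcMonomial c k := by
      rw [Finset.smul_sum]
      refine Finset.sum_congr rfl fun k _ => ?_
      rw [polarForm_monomial, smul_smul]
      rfl
    rw [h2]
    exact Subalgebra.smul_mem _ (sum_polarForm_mem_range c hw hf d) _
  · intro d _ d' _ hdd
    rw [Function.onFun, Finset.disjoint_left]
    intro k hk hk'
    exact hdd ((Finset.mem_finsuppAntidiag.mp hk).1.symm.trans
      (Finset.mem_finsuppAntidiag.mp hk').1)

theorem CaseTwo.surjective_pStar [Fintype ι] (h : CaseTwo w) :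
    Function.Surjective (pStar w ⊤) := by
  classical
  have hw : ∀ i, w i = 0 ∨ w i = 1 ∨ w i = -1 := fun i => by
    by_cases hi : w i = 0
    · exact Or.inl hi
    · exact Or.inr (h i hi)
  rintro ⟨f, hf⟩
  obtain ⟨x, hx⟩ := mem_range_of_mem_jetInv hw hf
  exact ⟨x, Subtype.ext hx⟩

/-- Outside case (2) some weight has absolute value at least `2`. Without bad pairs, all weights of
the opposite sign are `±1`, and outside case (1) there are at least two of them. -/
theorem exists_badPair_or_badTriple (hpos : ∃ i, 0 < w i) (hneg : ∃ j, w j < 0)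
    (h : ¬ (CaseOne w ∨ CaseTwo w)) :
    (∃ i j, BadPair w i j) ∨ ∃ i₁ i₂ j s, BadTriple w i₁ i₂ j s := by
  obtain ⟨h1, h2⟩ := not_or.mp h
  rw [CaseOne, not_or] at h1
  obtain ⟨h1p, h1n⟩ := h1
  push Not at h1p h1n
  by_contra! hcon
  obtain ⟨hP, hT⟩ := hcon
  rw [CaseTwo] at h2
  push Not at h2
  obtain ⟨i, hi0, hi1, hi2⟩ := h2
  rcases lt_or_gt_of_ne hi0 with hi | hi
  · obtain ⟨j, hj⟩ := hpos
    have hone : ∀ j, 0 < w j → w j = 1 := fun j hj => by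
      have := hP j i
      rw [BadPair] at this
      omega
    obtain ⟨k, hk, hkj⟩ := h1p j (hone j hj)
    exact hT k j i (w i).natAbs ⟨hkj, by omega, Or.inl ⟨hone k hk, hone j hj, by omega⟩⟩
  · obtain ⟨j, hj⟩ := hneg
    have hone : ∀ j, w j < 0 → w j = -1 := fun j hj => by
      have := hP i j
      rw [BadPair] at this
      omega
    obtain ⟨k, hk, hkj⟩ := h1n j (hone j hj)
    exact hT k j i (w i).natAbs ⟨hkj, by omega, Or.inr ⟨hone k hk, hone j hj, by omega⟩⟩

end CaseTwo

end ArcInv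
end

theorem mainTheorem8 {ι : Type*} [Fintype ι] (w : ι → ℤ)
    (hpos : ∃ i, 0 < w i) (hneg : ∃ j, w j < 0) (hgcd : Finset.univ.gcd w = 1) :
    -- the classification
    (Function.Surjective (ArcInv.pStar w ⊤) ↔ ArcInv.CaseOne w ∨ ArcInv.CaseTwo w) ∧
    -- the first case
    (ArcInv.CaseOne w → ArcInv.maxRankImage w = Set.univ ∧
      ∀ m : ℕ∞, Function.Bijective (ArcInv.pStar w m)) ∧
    -- all other representations, and the new invariants that they have
    (¬ (ArcInv.CaseOne w ∨ ArcInv.CaseTwo w) →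
      (∃ i j, ArcInv.BadPair w i j) ∨ ∃ i₁ i₂ j s, ArcInv.BadTriple w i₁ i₂ j s) ∧
    (∀ i₁ i₂ j s, ArcInv.BadTriple w i₁ i₂ j s →
      ArcInv.IsNewInvariant w
        ((ArcInv.arcX i₁ * ArcInv.arcD ι (ArcInv.arcX i₂) -
          ArcInv.arcX i₂ * ArcInv.arcD ι (ArcInv.arcX i₁)) *
            ArcInv.arcX i₁ ^ (s - 2) * ArcInv.arcX j)) ∧
    (∀ i j, ArcInv.BadPair w i j → Int.gcd (w i) (w j) = 1 →
      ∃ f q, ArcInv.IsNewInvariant w f ∧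
        q = ArcInv.arcX i ^ (w j).natAbs * ArcInv.arcX j ^ (w i).natAbs ∧
        f * q = (ArcInv.arcD ι q) ^ 2) ∧
    (∀ i j, ArcInv.BadPair w i j → Int.gcd (w i) (w j) ≠ 1 →
      ∃ (k : ι) (n α β : ℕ), ¬ (Int.gcd (w i) (w j) : ℤ) ∣ w k ∧
        n = Int.gcd (w i) (w j) / Int.gcd (Int.gcd (w i) (w j)) (w k) ∧
        2 ≤ α ∧ 2 ≤ β ∧ n * w k + α * w i + β * w j = 0 ∧
        ∃ f q, ArcInv.IsNewInvariant w f ∧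
          q = ArcInv.arcX k ^ n * ArcInv.arcX i ^ α * ArcInv.arcX j ^ β ∧
          f * q = (ArcInv.arcD ι q) ^ 2) := by
  have hnew : ∀ f, ArcInv.IsNewInvariant w f → ¬ Function.Surjective (ArcInv.pStar w ⊤) :=
    fun f ⟨hf, hfr⟩ hs => hfr (hs ⟨f, hf⟩)
  have hbad := ArcInv.exists_badPair_or_badTriple hpos hneg
  refine ⟨⟨fun hs => ?_, ?_⟩, fun h => ?_, hbad, fun i₁ i₂ j s h => h.isNewInvariant,
    fun i j h hg => h.exists_isNewInvariant hg,
    fun i j h hg => h.exists_isNewInvariant_of_gcd_ne_one hgcd hg⟩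
  · by_contra hcase
    rcases hbad hcase with ⟨i, j, h⟩ | ⟨i₁, i₂, j, s, h⟩
    · by_cases hg : Int.gcd (w i) (w j) = 1
      · obtain ⟨f, _, hf, _⟩ := h.exists_isNewInvariant hg
        exact hnew f hf hs
      · obtain ⟨_, _, _, _, _, _, _, _, _, f, _, hf, _⟩ :=
          h.exists_isNewInvariant_of_gcd_ne_one hgcd hg
        exact hnew f hf hs
    · exact hnew _ h.isNewInvariant hs
  · rintro (h | h)
    · obtain ⟨i₀, h₀⟩ := h.exists_isSlice
      exact (h₀.bijective_pStar ⊤).2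
    · exact h.surjective_pStar
  · obtain ⟨i₀, h₀⟩ := h.exists_isSlice
    exact ⟨h₀.maxRankImage_eq, h₀.bijective_pStar⟩
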